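/- Let $n\ge 2$ and let $(W,S)$ be a Coxeter system of type $\tilde A_{n-1}$ (so $|S|=n$; the Coxeter diagram is an $n$-cycle if $n\ge 3$, and $W$ is the infinite dihedral group if $n=2$). Let $R$ be the set of reflections, i.e. of conjugates of elements of $S$. For $w\in W$ let $l_R(w)$ be the least number of factors in an expression of $w$ as a product of reflections, and say that $v$ divides $w$ if $w=vv'$ for some $v'\in W$ with $l_R(w)=l_R(v)+l_R(v')$. Let $c$ be a Coxeter element, i.e. the product of all the elements of $S$, each taken once, in some order, and let $P_c$ be the set of divisors of $c$. Let $M(P_c)$ be the monoid generated by symbols $\underline w$ ($w\in P_c$), with the relations $\underline w\cdot\underline{w'}=\underline{ww'}$ whenever $w,w',ww'\in P_c$ and $l_R(ww')=l_R(w)+l_R(w')$, and with $\underline 1$ equal to the unit of the monoid. Then, as a monoid, $M(P_c)$ is presented by the generators $\underline r$, for $r\in R$ dividing $c$, with the relations $$\underline r\cdot\underline t=\underline{rtr}\cdot\underline r\qquad\text{for all } r,t\in R \text{ such that } r\ne t \text{ and } rt \text{ divides } c$$ (for such $r,t$ the reflections $r$, $t$ and $rtr$ all divide $c$). Likewise,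 as a group, the group of fractions of $M(P_c)$ (the group generated by the elements of $M(P_c)$ subject to the multiplication table of $M(P_c)$) is presented by the same generators and relations. -/

import Mathlib

namespace DualArtin

/-- The Coxeter matrix of affine type `Ã_{n-1}` (with `n` generators, indexed by `Fin n`): the
Coxeter diagram is the `n`-cycle for `n ≥ 3`, and for `n = 2` it is a single edge labelled `∞`
(encoded by `0` in Mathlib), so that the group is the infinite dihedral group. -/
def affineA (n : ℕ) : CoxeterMatrix (Fin n) where
  M := Matrix.of fun i j : Fin n =>
    if i = j then 1
    else if n = 2 then 0
    else if ((i : ℕ) + 1) % n = (j : ℕ) ∨ ((j : ℕ) + 1) % n = (i : ℕ) then 3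
    else 2
  isSymm := by
    ext i j
    simp only [Matrix.transpose_apply, Matrix.of_apply, eq_comm (a := j) (b := i),
      or_comm (a := ((j : ℕ) + 1) % n = (i : ℕ))]
  diagonal := by simp
  off_diagonal := by
    intro i j h
    simp only [Matrix.of_apply, if_neg h]
    split_ifs <;> simp

section Coxeter

variable {B W : Type*} [Group W] {M : CoxeterMatrix B} (cs : CoxeterSystem M W)

/-- A Coxeter element: the product of all the simple reflections, each occurring exactly once,
in some order. -/
def IsCoxeterElement (c : W) : Prop :=
  ∃ l : List B, l.Nodup ∧ (∀ i, i ∈ l) ∧ c = cs.wordProd l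

theorem exists_reflection_word (w : W) :
    ∃ k, ∃ l : List W, (∀ r ∈ l, cs.IsReflection r) ∧ l.prod = w ∧ l.length = k := by
  obtain ⟨ω, -, rfl⟩ := cs.exists_isReduced w
  refine ⟨_, ω.map cs.simple, ?_, rfl, rfl⟩
  intro r hr
  obtain ⟨i, -, rfl⟩ := List.mem_map.1 hr
  exact cs.isReflection_simple i

open Classical in
/-- The reflection length `l_R(w)`: the least number of factors in an expression of `w` as a
product of reflections. -/
noncomputable def reflLength (w : W) : ℕ := Nat.find (exists_reflection_word cs w)

/-- Divisibility: `v ≼ w` if `w = v v'` with `l_R(w) = l_R(v) + l_R(v')`. -/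
def Divides (v w : W) : Prop :=
  ∃ v' : W, w = v * v' ∧ reflLength cs w = reflLength cs v + reflLength cs v'

theorem reflLength_prod_le (l : List W) (hl : ∀ r ∈ l, cs.IsReflection r) :
    reflLength cs l.prod ≤ l.length := by
  classical
  exact Nat.find_min' _ ⟨l, hl, rfl, rfl⟩

theorem exists_reduced_reflection_word (w : W) :
    ∃ l : List W, (∀ r ∈ l, cs.IsReflection r) ∧ l.prod = w ∧ l.length = reflLength cs w := by
  classical
  exact Nat.find_spec (exists_reflection_word cs w)

theorem reflLength_one : reflLength cs 1 = 0 := by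
  simpa using reflLength_prod_le cs [] (by simp)

theorem reflLength_mul_le (v w : W) :
    reflLength cs (v * w) ≤ reflLength cs v + reflLength cs w := by
  obtain ⟨l, hl, rfl, hl'⟩ := exists_reduced_reflection_word cs v
  obtain ⟨m, hm, rfl, hm'⟩ := exists_reduced_reflection_word cs w
  rw [← hl', ← hm', ← List.prod_append, ← List.length_append]
  apply reflLength_prod_le
  intro r hr
  rcases List.mem_append.1 hr with h | h
  · exact hl r h
  · exact hm r h

theorem reflLength_le_one {r : W} (hr : cs.IsReflection r) : reflLength cs r ≤ 1 := by
  simpa using reflLength_prod_le cs [r] (by simpa using hr)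

theorem reflLength_eq_one {r : W} (hr : cs.IsReflection r) : reflLength cs r = 1 := by
  have h := reflLength_le_one cs hr
  obtain ⟨l, -, hl, hl'⟩ := exists_reduced_reflection_word cs r
  by_contra hne
  have h0 : l = [] := List.length_eq_zero_iff.1 (by omega)
  have h1 : r = 1 := by rw [← hl, h0, List.prod_nil]
  have := hr.odd_length
  simp [h1] at this

theorem reflLength_mul_eq_two {r t : W} (hr : cs.IsReflection r) (ht : cs.IsReflection t)
    (hne : r ≠ t) : reflLength cs (r * t) = 2 := by
  have h := reflLength_mul_le cs r t
  rw [reflLength_eq_one cs hr, reflLength_eq_one cs ht] at h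
  obtain ⟨l, hl, hp, hl'⟩ := exists_reduced_reflection_word cs (r * t)
  by_contra hc
  have h2 : reflLength cs (r * t) = 0 ∨ reflLength cs (r * t) = 1 := by omega
  rcases h2 with h0 | h1
  · have hnil : l = [] := List.length_eq_zero_iff.1 (by omega)
    rw [hnil, List.prod_nil] at hp
    apply hne
    have := eq_inv_of_mul_eq_one_left hp.symm
    rwa [ht.inv] at this
  · obtain ⟨u, rfl⟩ := List.length_eq_one_iff.1 (hl'.trans h1)
    have hu : cs.IsReflection u := hl u (by simp)
    rw [List.prod_singleton] at hp
    have hodd := hu.odd_length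
    rw [hp, Nat.odd_iff, cs.length_mul_mod_two, Nat.add_mod, Nat.odd_iff.1 hr.odd_length,
      Nat.odd_iff.1 ht.odd_length] at hodd
    omega

theorem isReflection_conj {r t : W} (hr : cs.IsReflection r) (ht : cs.IsReflection t) :
    cs.IsReflection (r * t * r) := by
  simpa only [hr.inv] using ht.conj r

theorem divides_left {r t c : W} (hr : cs.IsReflection r) (ht : cs.IsReflection t)
    (hne : r ≠ t) (h : Divides cs (r * t) c) : Divides cs r c := by
  obtain ⟨v, hv, hlen⟩ := h
  rw [reflLength_mul_eq_two cs hr ht hne] at hlen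
  have e : c = r * (t * v) := by rw [hv, mul_assoc]
  refine ⟨t * v, e, ?_⟩
  have h1 := reflLength_mul_le cs t v
  have h2 := reflLength_mul_le cs r (t * v)
  rw [← e] at h2
  rw [reflLength_eq_one cs ht] at h1
  rw [reflLength_eq_one cs hr] at h2 ⊢
  omega

theorem divides_conj {r t c : W} (hr : cs.IsReflection r) (ht : cs.IsReflection t)
    (hne : r ≠ t) (h : Divides cs (r * t) c) : Divides cs (r * t * r) c := by
  apply divides_left cs (isReflection_conj cs hr ht) hr
  · intro he
    apply hne
    have h1 : r * t = 1 := mul_eq_right.1 he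
    have := eq_inv_of_mul_eq_one_left h1
    rwa [ht.inv] at this
  · rwa [mul_assoc (r * t), hr.mul_self, mul_one]

theorem divides_right {r t c : W} (hr : cs.IsReflection r) (ht : cs.IsReflection t)
    (hne : r ≠ t) (h : Divides cs (r * t) c) : Divides cs t c := by
  apply divides_left cs ht (isReflection_conj cs ht hr)
  · intro he
    apply hne
    have h1 : t * r = 1 := by
      apply mul_right_cancel (b := t)
      rw [← he, one_mul]
    have := eq_inv_of_mul_eq_one_left h1
    rw [hr.inv] at this
    exact this.symm
  · have e : t * (t * r * t) = r * t := by
      rw [← mul_assoc, ← mul_assoc, ht.mul_self, one_mul]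
    rwa [e]

theorem one_divides (c : W) : Divides cs 1 c :=
  ⟨c, by simp, by simp [reflLength_one]⟩

/-- `P_c`, the set of divisors of `c`. -/
abbrev Divisor (c : W) : Type _ := {w : W // Divides cs w c}

/-- The defining relations of the dual monoid. The unit `1 ∈ P_c` is identified with the unit of
the monoid. -/
inductive DualRel (c : W) :
    FreeMonoid (Divisor cs c) → FreeMonoid (Divisor cs c) → Prop
  | one : DualRel c (FreeMonoid.of ⟨1, one_divides cs c⟩) 1
  | mul (w w' : W) (hw : Divides cs w c) (hw' : Divides cs w' c) (hww' : Divides cs (w * w') c)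
      (hlen : reflLength cs (w * w') = reflLength cs w + reflLength cs w') :
      DualRel c (FreeMonoid.of ⟨w, hw⟩ * FreeMonoid.of ⟨w', hw'⟩)
        (FreeMonoid.of ⟨w * w', hww'⟩)

/-- The dual monoid `M(P_c)`. -/
abbrev DualMonoid (c : W) : Type _ := PresentedMonoid (DualRel cs c)

/-- The element `w̲` of `M(P_c)` attached to `w ∈ P_c`. -/
def DualMonoid.under (c w : W) (hw : Divides cs w c) : DualMonoid cs c :=
  PresentedMonoid.of (DualRel cs c) ⟨w, hw⟩

/-- The set `R ∩ P_c` of reflections that divide `c`. -/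
abbrev ReflDivisor (c : W) : Type _ := {r : W // cs.IsReflection r ∧ Divides cs r c}

/-- The relations `r̲ t̲ = (rtr)̲ r̲`, one for each pair of distinct reflections `r`, `t` such that
`rt` divides `c`. -/
inductive HurwitzRel (c : W) :
    FreeMonoid (ReflDivisor cs c) → FreeMonoid (ReflDivisor cs c) → Prop
  | rel (r t : W) (hr : cs.IsReflection r) (ht : cs.IsReflection t) (hne : r ≠ t)
      (h : Divides cs (r * t) c) :
      HurwitzRel c
        (FreeMonoid.of ⟨r, hr, divides_left cs hr ht hne h⟩ *
          FreeMonoid.of ⟨t, ht, divides_right cs hr ht hne h⟩)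
        (FreeMonoid.of ⟨r * t * r, isReflection_conj cs hr ht, divides_conj cs hr ht hne h⟩ *
          FreeMonoid.of ⟨r, hr, divides_left cs hr ht hne h⟩)

/-- The same relations, as relators of a group presentation. -/
def hurwitzRelators (c : W) : Set (FreeGroup (ReflDivisor cs c)) :=
  {x | ∃ a b : FreeMonoid (ReflDivisor cs c), HurwitzRel cs c a b ∧
    x = FreeMonoid.lift FreeGroup.of a * (FreeMonoid.lift FreeGroup.of b)⁻¹}

end Coxeter

section Fractions

variable (N : Type*) [Monoid N]

/-- The group of fractions (universal enveloping group) of a monoid `N`: the group generated by the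
elements of `N`, subject to the multiplication table of `N`. -/
abbrev GroupOfFractions : Type _ :=
  PresentedGroup {x : FreeGroup N | ∃ a b : N,
    x = FreeGroup.of a * FreeGroup.of b * (FreeGroup.of (a * b))⁻¹}

/-- The canonical map from a monoid to its group of fractions. -/
def GroupOfFractions.ofMonoid (a : N) : GroupOfFractions N := PresentedGroup.of a

end Fractions

end DualArtin

/-! In M(P_c) the element attached to w is the product of any reduced reflection factorization of w.
So the claim amounts to this: modulo the relations r t = (rtr) r, all reduced factorizations of a
divisor w of c have the same value. By induction on l_R(w) (`hurwitzProd_eq`) it suffices that the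
possible first letters of w form a connected graph, r and t being joined when some reduced
factorization begins with r t. Indeed r t = t (trt) is one of the relations, so the values of the
words starting with r and with t then agree.

Connectivity is checked on affine permutations. W acts faithfully on ℤ by permutations commuting
with translation by n, and the reflections become the periodic transpositions (`affineModel`).
Following an orbit of w until it first returns to its starting class mod n gives a shift by k n;
call k the drift of that cycle of classes. Reflection length is at least the codimension of the
w-invariant functions with f (z + n) = 2 f z (`corank_le_reflLength`). The factor 2 forces such
functions to vanish on cycles of nonzero drift, so that these count towards the codimension.

A Coxeter element has exactly two cycles, of drifts 1 and -1 (`isAnnular_wordProd`). Removing a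
first letter either cuts a finite cycle off some cycle, or merges the two drifting cycles into one
of drift 0. Hence every divisor of c has either one cycle of drift 1, one of drift -1 and all others
of drift 0 (annular), or only cycles of drift 0 (elliptic); for these the lower bound is attained
(`IsAdmissible.reflLength_eq`), and the first letters can be listed.

For the graph, a transposition (z, w z) with w z not congruent to z serves as a hub. Such letters
exist for every elliptic w other than 1, and all first letters connect through them. The annular w
without any such letter behave like a translation in the infinite dihedral group, where the letters
(a, b + k n) form a chain indexed by k (`IsAnnular.connected_of_no_arrow`). -/

namespace DualArtin

/-- The `n`-periodic transposition of the integers exchanging `x + k n` and `y + k n`. -/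
def periodicSwap (n : ℕ) (x y z : ℤ) : ℤ :=
  if z ≡ x [ZMOD n] then z - x + y else if z ≡ y [ZMOD n] then z - y + x else z

/-! ### Periodic transpositions, periodic permutations, quasiperiodic functions -/

section PeriodicSwap

variable {n : ℕ} {x y z : ℤ}

theorem modEq_iff_exists_add : z ≡ x [ZMOD n] ↔ ∃ k : ℤ, z = x + k * n := by
  rw [Int.modEq_comm, Int.modEq_iff_dvd]
  constructor
  · rintro ⟨k, hk⟩
    exact ⟨k, by linarith⟩
  · rintro ⟨k, rfl⟩
    exact ⟨k, by ring⟩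

theorem add_mul_modEq (x k : ℤ) : x + k * n ≡ x [ZMOD n] :=
  modEq_iff_exists_add.2 ⟨k, rfl⟩

theorem periodicSwap_of_left (h : z ≡ x [ZMOD n]) : periodicSwap n x y z = z - x + y := if_pos h

theorem periodicSwap_of_right (hxy : ¬ x ≡ y [ZMOD n]) (h : z ≡ y [ZMOD n]) :
    periodicSwap n x y z = z - y + x := by
  rw [periodicSwap, if_neg fun h' => hxy (h'.symm.trans h), if_pos h]

theorem periodicSwap_of_ne (hx : ¬ z ≡ x [ZMOD n]) (hy : ¬ z ≡ y [ZMOD n]) :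
    periodicSwap n x y z = z := by
  rw [periodicSwap, if_neg hx, if_neg hy]

theorem periodicSwap_left (k : ℤ) : periodicSwap n x y (x + k * n) = y + k * n := by
  rw [periodicSwap_of_left (add_mul_modEq x k)]; ring

theorem periodicSwap_right (hxy : ¬ x ≡ y [ZMOD n]) (k : ℤ) :
    periodicSwap n x y (y + k * n) = x + k * n := by
  rw [periodicSwap_of_right hxy (add_mul_modEq y k)]; ring

@[simp] theorem periodicSwap_left_self : periodicSwap n x y x = y := by
  simpa using periodicSwap_left (n := n) (x := x) (y := y) 0

theorem periodicSwap_right_self (hxy : ¬ x ≡ y [ZMOD n]) : periodicSwap n x y y = x := by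
  simpa using periodicSwap_right hxy 0

theorem periodicSwap_cases (hxy : ¬ x ≡ y [ZMOD n]) (z : ℤ) :
    (∃ k : ℤ, z = x + k * n ∧ periodicSwap n x y z = y + k * n) ∨
    (∃ k : ℤ, z = y + k * n ∧ periodicSwap n x y z = x + k * n) ∨
    (¬ z ≡ x [ZMOD n] ∧ ¬ z ≡ y [ZMOD n] ∧ periodicSwap n x y z = z) := by
  by_cases h : z ≡ x [ZMOD n]
  · obtain ⟨k, rfl⟩ := modEq_iff_exists_add.1 h
    exact Or.inl ⟨k, rfl, periodicSwap_left k⟩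
  by_cases h' : z ≡ y [ZMOD n]
  · obtain ⟨k, rfl⟩ := modEq_iff_exists_add.1 h'
    exact Or.inr (Or.inl ⟨k, rfl, periodicSwap_right hxy k⟩)
  · exact Or.inr (Or.inr ⟨h, h', periodicSwap_of_ne h h'⟩)

theorem not_modEq_symm (hxy : ¬ x ≡ y [ZMOD n]) : ¬ y ≡ x [ZMOD n] := fun h => hxy h.symm

theorem periodicSwap_comm (hxy : ¬ x ≡ y [ZMOD n]) (z : ℤ) :
    periodicSwap n x y z = periodicSwap n y x z := by
  rcases periodicSwap_cases hxy z with ⟨k, rfl, h⟩ | ⟨k, rfl, h⟩ | ⟨h1, h2, h⟩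
  · rw [h, periodicSwap_right (not_modEq_symm hxy)]
  · rw [h, periodicSwap_left]
  · rw [h, periodicSwap_of_ne h2 h1]

theorem periodicSwap_shift (k : ℤ) (z : ℤ) :
    periodicSwap n (x + k * n) (y + k * n) z = periodicSwap n x y z := by
  have e (x : ℤ) : z ≡ x + k * n [ZMOD n] ↔ z ≡ x [ZMOD n] :=
    ⟨fun h => h.trans (add_mul_modEq x k), fun h => h.trans (add_mul_modEq x k).symm⟩
  simp only [periodicSwap, e]
  split_ifs <;> ring

theorem periodicSwap_add (hxy : ¬ x ≡ y [ZMOD n]) (z k : ℤ) :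
    periodicSwap n x y (z + k * n) = periodicSwap n x y z + k * n := by
  rcases periodicSwap_cases hxy z with ⟨j, rfl, h⟩ | ⟨j, rfl, h⟩ | ⟨h1, h2, h⟩
  · rw [h, show x + j * n + k * n = x + (j + k) * n by ring, periodicSwap_left]; ring
  · rw [h, show y + j * n + k * n = y + (j + k) * n by ring, periodicSwap_right hxy]; ring
  · rw [h, periodicSwap_of_ne]
    · exact fun h => h1 ((add_mul_modEq z k).symm.trans h)
    · exact fun h => h2 ((add_mul_modEq z k).symm.trans h)

theorem periodicSwap_involutive (hxy : ¬ x ≡ y [ZMOD n]) :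
    Function.Involutive (periodicSwap n x y) := by
  intro z
  rcases periodicSwap_cases hxy z with ⟨j, rfl, h⟩ | ⟨j, rfl, h⟩ | ⟨h1, h2, h⟩
  · rw [h, periodicSwap_right hxy]
  · rw [h, periodicSwap_left]
  · rw [h, h]

theorem map_add_mul_of_map_add {u : ℤ → ℤ} (hu : ∀ z, u (z + n) = u z + n) (z k : ℤ) :
    u (z + k * n) = u z + k * n := by
  induction k using Int.induction_on with
  | zero => simp
  | succ i ih => rw [show z + (i + 1 : ℤ) * n = z + i * n + n by ring, hu, ih]; ring
  | pred i ih =>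
    have := hu (z + (-i - 1 : ℤ) * n)
    rw [show z + (-i - 1 : ℤ) * n + n = z + (-i : ℤ) * n by ring, ih] at this
    linarith

theorem modEq_of_map_modEq {u : Equiv.Perm ℤ} (hu : ∀ z, u (z + n) = u z + n)
    (h : u x ≡ u y [ZMOD n]) : x ≡ y [ZMOD n] := by
  obtain ⟨k, hk⟩ := modEq_iff_exists_add.1 h
  rw [← map_add_mul_of_map_add hu] at hk
  exact modEq_iff_exists_add.2 ⟨k, u.injective hk⟩

theorem map_modEq {u : ℤ → ℤ} (hu : ∀ z, u (z + n) = u z + n)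
    (h : x ≡ y [ZMOD n]) : u x ≡ u y [ZMOD n] := by
  obtain ⟨k, rfl⟩ := modEq_iff_exists_add.1 h
  rw [map_add_mul_of_map_add hu]
  exact add_mul_modEq _ _

theorem map_periodicSwap {u : Equiv.Perm ℤ} (hu : ∀ z, u (z + n) = u z + n)
    (hxy : ¬ x ≡ y [ZMOD n]) (z : ℤ) :
    u (periodicSwap n x y z) = periodicSwap n (u x) (u y) (u z) := by
  have hxy' : ¬ u x ≡ u y [ZMOD n] := fun h => hxy (modEq_of_map_modEq hu h)
  rcases periodicSwap_cases hxy z with ⟨j, rfl, h⟩ | ⟨j, rfl, h⟩ | ⟨h1, h2, h⟩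
  · rw [h, map_add_mul_of_map_add hu, map_add_mul_of_map_add hu, periodicSwap_left]
  · rw [h, map_add_mul_of_map_add hu, map_add_mul_of_map_add hu, periodicSwap_right hxy']
  · rw [h, periodicSwap_of_ne]
    · exact fun h => h1 (modEq_of_map_modEq hu h)
    · exact fun h => h2 (modEq_of_map_modEq hu h)

theorem height_add_mul {h : ℤ → ℤ} (hh : ∀ z, h (z + n) = h z + 1) (z k : ℤ) :
    h (z + k * n) = h z + k := by
  induction k using Int.induction_on with
  | zero => simp
  | succ i ih => rw [show z + (i + 1 : ℤ) * n = z + i * n + n by ring, hh, ih]; ring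
  | pred i ih =>
    have := hh (z + (-i - 1 : ℤ) * n)
    rw [show z + (-i - 1 : ℤ) * n + n = z + (-i : ℤ) * n by ring, ih] at this
    linarith

theorem quasiperiodic_add_mul {f : ℤ → ℚ} (hf : ∀ z, f (z + n) = 2 * f z) (z k : ℤ) :
    f (z + k * n) = 2 ^ k * f z := by
  induction k using Int.induction_on with
  | zero => simp
  | succ i ih =>
    rw [show z + (i + 1 : ℤ) * n = z + i * n + n by ring, hf, ih, zpow_add₀ two_ne_zero]; ring
  | pred i ih =>
    have := hf (z + (-i - 1 : ℤ) * n)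
    rw [show z + (-i - 1 : ℤ) * n + n = z + (-i : ℤ) * n by ring, ih] at this
    rw [zpow_sub₀ two_ne_zero]
    linarith

end PeriodicSwap

/-! ### Periodic models and the corank bound for reflection length -/

/-- A faithful action of `W` on the integers by `n`-periodic permutations, in which the reflections
are exactly the periodic transpositions. -/
structure PeriodicModel {B W : Type*} [Group W] {M : CoxeterMatrix B} (cs : CoxeterSystem M W)
    (n : ℕ) where
  /-- the action -/
  toHom : W →* Equiv.Perm ℤ
  pos : 0 < n
  injective : Function.Injective toHom
  map_add : ∀ w z, toHom w (z + n) = toHom w z + n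
  exists_swap : ∀ r, cs.IsReflection r →
    ∃ x y, ¬ x ≡ y [ZMOD n] ∧ ∀ z, toHom r z = periodicSwap n x y z
  exists_reflection : ∀ x y : ℤ, ¬ x ≡ y [ZMOD n] →
    ∃ r, cs.IsReflection r ∧ ∀ z, toHom r z = periodicSwap n x y z

namespace PeriodicModel

variable {B W : Type*} [Group W] {M : CoxeterMatrix B} {cs : CoxeterSystem M W} {n : ℕ}
  (P : PeriodicModel cs n)

theorem map_add_mul (w : W) (z k : ℤ) : P.toHom w (z + k * n) = P.toHom w z + k * n :=
  map_add_mul_of_map_add (P.map_add w) z k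

theorem mul_apply (v w : W) (z : ℤ) : P.toHom (v * w) z = P.toHom v (P.toHom w z) := by simp

theorem modEq_iff (w : W) {x y : ℤ} :
    P.toHom w x ≡ P.toHom w y [ZMOD n] ↔ x ≡ y [ZMOD n] :=
  ⟨modEq_of_map_modEq (P.map_add w), map_modEq (P.map_add w)⟩

theorem ext {v w : W} (h : ∀ z, P.toHom v z = P.toHom w z) : v = w :=
  P.injective (Equiv.ext h)

/-- The reflection `r` acts as the periodic transposition of `x` and `y`. -/
def ActsAsSwap (r : W) (x y : ℤ) : Prop :=
  cs.IsReflection r ∧ ¬ x ≡ y [ZMOD n] ∧ ∀ z, P.toHom r z = periodicSwap n x y z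

variable {P}

theorem ActsAsSwap.symm {r : W} {x y : ℤ} (h : P.ActsAsSwap r x y) : P.ActsAsSwap r y x :=
  ⟨h.1, not_modEq_symm h.2.1, fun z => by rw [h.2.2, periodicSwap_comm h.2.1]⟩

theorem ActsAsSwap.eq_of_shift {r t : W} {x y : ℤ} (k : ℤ) (h : P.ActsAsSwap r x y)
    (h' : P.ActsAsSwap t (x + k * n) (y + k * n)) : r = t :=
  P.ext fun z => by rw [h.2.2, h'.2.2, periodicSwap_shift]

theorem ActsAsSwap.unique {r t : W} {x y : ℤ} (h : P.ActsAsSwap r x y)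
    (h' : P.ActsAsSwap t x y) : r = t :=
  P.ext fun z => by rw [h.2.2, h'.2.2]

variable (P)

theorem exists_actsAsSwap {r : W} (hr : cs.IsReflection r) : ∃ x y, P.ActsAsSwap r x y := by
  obtain ⟨x, y, h, h'⟩ := P.exists_swap r hr
  exact ⟨x, y, hr, h, h'⟩

theorem exists_reflection_actsAsSwap {x y : ℤ} (h : ¬ x ≡ y [ZMOD n]) :
    ∃ r, P.ActsAsSwap r x y := by
  obtain ⟨r, hr, h'⟩ := P.exists_reflection x y h
  exact ⟨r, hr, h, h'⟩

/-- The `2`-quasiperiodic functions that are invariant under `w`. -/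
def invariants (w : W) : Submodule ℚ (ℤ → ℚ) where
  carrier := {f | (∀ z, f (z + n) = 2 * f z) ∧ ∀ z, f (P.toHom w z) = f z}
  add_mem' := by
    rintro f g ⟨h1, h2⟩ ⟨h3, h4⟩
    exact ⟨fun z => by simp only [Pi.add_apply, h1, h3]; ring, fun z => by simp [h2, h4]⟩
  zero_mem' := by simp
  smul_mem' := by
    rintro a f ⟨h1, h2⟩
    exact ⟨fun z => by simp only [Pi.smul_apply, smul_eq_mul, h1]; ring, fun z => by simp [h2]⟩

theorem invariants_le_one (w : W) : P.invariants w ≤ P.invariants 1 :=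
  fun _ hf => ⟨hf.1, by simp⟩

/-- Quasiperiodicity determines a function from its values on 0, ..., n - 1, so restriction embeds
the space in ℚ^n. -/
instance finiteDimensional_invariants (w : W) : FiniteDimensional ℚ (P.invariants w) := by
  have hn : (0 : ℤ) < n := by exact_mod_cast P.pos
  let φ : P.invariants w →ₗ[ℚ] (Fin n → ℚ) :=
    { toFun := fun f i => f.1 i
      map_add' := fun _ _ => rfl
      map_smul' := fun _ _ => rfl }
  apply FiniteDimensional.of_injective φ
  rw [← LinearMap.ker_eq_bot, LinearMap.ker_eq_bot']
  intro f hf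
  ext z
  have h0 := Int.emod_nonneg z hn.ne'
  have h1 := Int.emod_lt_of_pos z hn
  have h2 := congrFun hf ⟨(z % n).toNat, by omega⟩
  have h3 : f.1 (z % n) = 0 := by simpa [φ, Int.toNat_of_nonneg h0] using h2
  have h4 := quasiperiodic_add_mul f.2.1 (z % n) (z / n)
  rw [h3, mul_zero, mul_comm, Int.emod_add_mul_ediv z n] at h4
  simpa using h4

/-- The codimension of the space of invariants. -/
noncomputable def corank (w : W) : ℕ :=
  Module.finrank ℚ (P.invariants 1) - Module.finrank ℚ (P.invariants w)

theorem finrank_invariants_le (w : W) :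
    Module.finrank ℚ (P.invariants w) ≤ Module.finrank ℚ (P.invariants 1) :=
  Submodule.finrank_mono (P.invariants_le_one w)

theorem corank_one : P.corank 1 = 0 := by simp [corank]

/-- A function fixed by v and by w is fixed by v w; the dimension formula for the sum and
intersection of the two invariant spaces gives subadditivity. -/
theorem corank_mul_le (v w : W) : P.corank (v * w) ≤ P.corank v + P.corank w := by
  have h1 := Submodule.finrank_sup_add_finrank_inf_eq (P.invariants v) (P.invariants w)
  have h2 : Module.finrank ℚ ↥(P.invariants v ⊔ P.invariants w) ≤
      Module.finrank ℚ (P.invariants 1) :=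
    Submodule.finrank_mono (sup_le (P.invariants_le_one v) (P.invariants_le_one w))
  have h3 : Module.finrank ℚ ↥(P.invariants v ⊓ P.invariants w) ≤
      Module.finrank ℚ (P.invariants (v * w)) := by
    refine Submodule.finrank_mono fun f hf => ⟨hf.1.1, fun z => ?_⟩
    rw [mul_apply, hf.1.2, hf.2.2]
  have h4 := P.finrank_invariants_le v
  have h5 := P.finrank_invariants_le w
  unfold corank
  omega

theorem mem_invariants_of_actsAsSwap {r : W} {x y : ℤ} (hr : P.ActsAsSwap r x y) {f : ℤ → ℚ}
    (hf : ∀ z, f (z + n) = 2 * f z) : f ∈ P.invariants r ↔ f x = f y := by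
  refine ⟨fun h => ?_, fun h => ⟨hf, fun z => ?_⟩⟩
  · rw [← h.2 x, hr.2.2, periodicSwap_left_self]
  · rw [hr.2.2]
    rcases periodicSwap_cases hr.2.1 z with ⟨j, rfl, h'⟩ | ⟨j, rfl, h'⟩ | ⟨h1, h2, h'⟩
    · rw [h', quasiperiodic_add_mul hf, quasiperiodic_add_mul hf, h]
    · rw [h', quasiperiodic_add_mul hf, quasiperiodic_add_mul hf, h]
    · rw [h']

/-- The invariants of the swap of x and y are cut out by the single linear condition f x = f y. -/
theorem corank_reflection_le {r : W} (hr : cs.IsReflection r) : P.corank r ≤ 1 := by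
  obtain ⟨x, y, hr⟩ := P.exists_actsAsSwap hr
  let φ : P.invariants 1 →ₗ[ℚ] ℚ :=
    { toFun := fun f => f.1 x - f.1 y
      map_add' := fun f g => by simp only [Submodule.coe_add, Pi.add_apply]; ring
      map_smul' := fun a f => by
        simp only [Submodule.coe_smul, Pi.smul_apply, smul_eq_mul, RingHom.id_apply]; ring }
  have h1 := φ.finrank_range_add_finrank_ker
  have h2 : Module.finrank ℚ (LinearMap.range φ) ≤ 1 := by
    simpa using Submodule.finrank_le (LinearMap.range φ)
  have h3 : Module.finrank ℚ (LinearMap.ker φ) ≤ Module.finrank ℚ (P.invariants r) := by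
    rw [← Submodule.finrank_map_subtype_eq]
    refine Submodule.finrank_mono ?_
    rintro _ ⟨f, hf, rfl⟩
    refine (P.mem_invariants_of_actsAsSwap hr f.2.1).2 ?_
    exact sub_eq_zero.1 hf
  unfold corank
  omega

theorem corank_le_reflLength (w : W) : P.corank w ≤ reflLength cs w := by
  obtain ⟨l, hl, rfl, hlen⟩ := exists_reduced_reflection_word cs w
  rw [← hlen]
  clear hlen
  induction l with
  | nil => simp [corank_one]
  | cons r l ih =>
    rw [List.prod_cons, List.length_cons]
    have h1 := P.corank_mul_le r l.prod
    have h2 := P.corank_reflection_le (hl r (by simp))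
    have h3 := ih fun r hr => hl r (by simp [hr])
    omega

theorem corank_lt_of_invariants_lt {v w : W} (h : P.invariants w < P.invariants v) :
    P.corank v < P.corank w := by
  have h1 := Submodule.finrank_lt_finrank_of_lt h
  have h2 := P.finrank_invariants_le v
  unfold corank
  omega

end PeriodicModel

/-! ### Elliptic and annular elements and their reflection length -/

namespace PeriodicModel

variable {B W : Type*} [Group W] {M : CoxeterMatrix B} {cs : CoxeterSystem M W} {n : ℕ}
  (P : PeriodicModel cs n)

/-- All orbits of `w` are finite, witnessed by an invariant height function. -/
def IsElliptic (w : W) : Prop :=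
  ∃ h : ℤ → ℤ, (∀ z, h (z + n) = h z + 1) ∧ ∀ z, h (P.toHom w z) = h z

/-- Up to translation, `w` has exactly two infinite orbits `U` and `V`, with opposite drifts
`1` and `-1`. -/
structure IsAnnular (w : W) (U V : Set ℤ) : Prop where
  nonempty_left : U.Nonempty
  nonempty_right : V.Nonempty
  disjoint : ∀ z, z ∈ U → z ∉ V
  periodic_left : ∀ y z : ℤ, y ≡ z [ZMOD n] → y ∈ U → z ∈ U
  periodic_right : ∀ y z : ℤ, y ≡ z [ZMOD n] → y ∈ V → z ∈ V
  stable_left : ∀ z, P.toHom w z ∈ U ↔ z ∈ U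
  stable_right : ∀ z, P.toHom w z ∈ V ↔ z ∈ V
  -- Unfolded, this says that h changes along `w` only on landing in the class of a (by +1) or of b
  -- (by -1). As a and b are arbitrary, it forces U and V to be single cycles of classes, of drifts
  -- 1 and -1, and every other cycle to have drift 0.
  exists_height : ∀ a ∈ U, ∀ b ∈ V, ∃ h : ℤ → ℤ, (∀ z, h (z + n) = h z + 1) ∧
    h a = h b + 1 ∧ ∀ z, h (periodicSwap n a b (P.toHom w z)) = h z

/-- The elements that occur as divisors of the Coxeter elements. -/
def IsAdmissible (w : W) : Prop :=
  P.IsElliptic w ∨ ∃ U V, P.IsAnnular w U V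

/-- `y` is reached from `x` along its `w`-orbit in `j` steps, through pairwise incongruent
integers. -/
def OrbitArc (w : W) (x y : ℤ) (j : ℕ) : Prop :=
  0 < j ∧ P.toHom (w ^ j) x = y ∧ ¬ x ≡ y [ZMOD n] ∧
    ∀ i, 0 < i → i < j → ¬ P.toHom (w ^ i) x ≡ x [ZMOD n]

/-- The `w`-orbit of `x` is infinite and reaches a translate of `x` before meeting `y`. -/
def Drifts (w : W) (x y : ℤ) : Prop :=
  ∃ j : ℕ, ∃ k : ℤ, k ≠ 0 ∧ P.toHom (w ^ j) x = x + k * n ∧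
    ∀ i, 0 < i → i ≤ j → ¬ P.toHom (w ^ i) x ≡ y [ZMOD n]

variable {P}

theorem pow_succ_apply (w : W) (i : ℕ) (x : ℤ) :
    P.toHom (w ^ (i + 1)) x = P.toHom w (P.toHom (w ^ i) x) := by
  rw [pow_succ', mul_apply]

theorem modEq_of_pow_modEq (w : W) {i j : ℕ} {x y : ℤ}
    (h : P.toHom (w ^ (i + j)) x ≡ P.toHom (w ^ i) y [ZMOD n]) :
    P.toHom (w ^ j) x ≡ y [ZMOD n] := by
  rwa [pow_add, mul_apply, P.modEq_iff] at h

/-- Pigeonhole on residues mod n, followed by cancelling the smaller power of w. -/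
theorem exists_return (w : W) (x : ℤ) : ∃ j, 0 < j ∧ P.toHom (w ^ j) x ≡ x [ZMOD n] := by
  have : NeZero n := ⟨P.pos.ne'⟩
  obtain ⟨i, j, hij, h⟩ :=
    Finite.exists_ne_map_eq_of_infinite fun i : ℕ => ((P.toHom (w ^ i) x : ℤ) : ZMod n)
  simp only [ZMod.intCast_eq_intCast_iff] at h
  rcases lt_or_gt_of_ne hij with hlt | hlt
  · obtain ⟨k, rfl⟩ := Nat.exists_eq_add_of_lt hlt
    exact ⟨k + 1, by omega, modEq_of_pow_modEq w h.symm⟩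
  · obtain ⟨k, rfl⟩ := Nat.exists_eq_add_of_lt hlt
    exact ⟨k + 1, by omega, modEq_of_pow_modEq w h⟩

theorem exists_first_return (w : W) (x y : ℤ) : ∃ j, 0 < j ∧
    (P.toHom (w ^ j) x ≡ x [ZMOD n] ∨ P.toHom (w ^ j) x ≡ y [ZMOD n]) ∧
    ∀ i, 0 < i → i < j → ¬ P.toHom (w ^ i) x ≡ x [ZMOD n] ∧ ¬ P.toHom (w ^ i) x ≡ y [ZMOD n] := by
  classical
  have hex : ∃ j, 0 < j ∧
      (P.toHom (w ^ j) x ≡ x [ZMOD n] ∨ P.toHom (w ^ j) x ≡ y [ZMOD n]) := by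
    obtain ⟨j, hj, h⟩ := P.exists_return w x
    exact ⟨j, hj, Or.inl h⟩
  refine ⟨Nat.find hex, (Nat.find_spec hex).1, (Nat.find_spec hex).2, fun i hi hij => ?_⟩
  have := Nat.find_min hex hij
  tauto

/-- If w^i x ≡ w^j x with i < j, then x would return to its class after j - i steps, too early
unless i = 0, which is excluded by x ≢ y. -/
theorem OrbitArc.not_modEq_right {w : W} {x y : ℤ} {j : ℕ} (h : P.OrbitArc w x y j) {i : ℕ}
    (hij : i < j) : ¬ P.toHom (w ^ i) x ≡ y [ZMOD n] := by
  obtain ⟨hj, rfl, hxy, hmin⟩ := h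
  rcases Nat.eq_zero_or_pos i with rfl | hi
  · simpa using hxy
  · intro hc
    obtain ⟨k, rfl⟩ := Nat.exists_eq_add_of_lt hij
    exact hmin (k + 1) (by omega) (by omega)
      (modEq_of_pow_modEq (i := i) w (by simpa [add_assoc] using hc.symm))

theorem height_periodicSwap {h : ℤ → ℤ} (hh : ∀ z, h (z + n) = h z + 1) {x y : ℤ}
    (hxy : ¬ x ≡ y [ZMOD n]) (he : h x = h y) (z : ℤ) : h (periodicSwap n x y z) = h z := by
  rcases periodicSwap_cases hxy z with ⟨j, rfl, h'⟩ | ⟨j, rfl, h'⟩ | ⟨-, -, h'⟩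
  · rw [h', height_add_mul hh, height_add_mul hh, he]
  · rw [h', height_add_mul hh, height_add_mul hh, he]
  · rw [h']

/-- The height of w still works: x and y lie on one w-orbit, hence at the same height, so the swap r
preserves it. -/
theorem IsElliptic.mul_of_orbitArc {w r : W} {x y : ℤ} {j : ℕ} (hw : P.IsElliptic w)
    (hr : P.ActsAsSwap r x y) (harc : P.OrbitArc w x y j) : P.IsElliptic (r * w) := by
  obtain ⟨h, hh, hinv⟩ := hw
  have hpow : ∀ i, h (P.toHom (w ^ i) x) = h x := by
    intro i
    induction i with
    | zero => simp
    | succ i ih => rw [pow_succ_apply, hinv, ih]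
  refine ⟨h, hh, fun z => ?_⟩
  rw [mul_apply, hr.2.2, height_periodicSwap hh hr.2.1 ?_, hinv]
  rw [← harc.2.1, hpow]

theorem IsAnnular.pow_mem_left_iff {w : W} {U V : Set ℤ} (hw : P.IsAnnular w U V) (i : ℕ)
    (x : ℤ) : P.toHom (w ^ i) x ∈ U ↔ x ∈ U := by
  induction i with
  | zero => simp
  | succ i ih => rw [pow_succ_apply, hw.stable_left, ih]

theorem IsAnnular.pow_mem_right_iff {w : W} {U V : Set ℤ} (hw : P.IsAnnular w U V) (i : ℕ)
    (x : ℤ) : P.toHom (w ^ i) x ∈ V ↔ x ∈ V := by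
  induction i with
  | zero => simp
  | succ i ih => rw [pow_succ_apply, hw.stable_right, ih]

variable (P) in
/-- The integers congruent to one of the first `j` points of the `w`-orbit of `x`. -/
def arcSet (w : W) (x : ℤ) (j : ℕ) : Set ℤ := {z | ∃ i < j, z ≡ P.toHom (w ^ i) x [ZMOD n]}

theorem arcSet_periodic {w : W} {x y z : ℤ} {j : ℕ} (h : y ≡ z [ZMOD n]) :
    y ∈ P.arcSet w x j ↔ z ∈ P.arcSet w x j := by
  constructor
  · rintro ⟨i, hi, h'⟩; exact ⟨i, hi, h.symm.trans h'⟩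
  · rintro ⟨i, hi, h'⟩; exact ⟨i, hi, h.trans h'⟩

/-- The product r w sends w^(j-1) x to r y = x, so the arc x, ..., w^(j-1) x closes into a finite
cycle, cut off from the rest of its w-orbit. -/
theorem OrbitArc.mem_arcSet_iff {w r : W} {x y : ℤ} {j : ℕ} (harc : P.OrbitArc w x y j)
    (hr : P.ActsAsSwap r x y) (z : ℤ) :
    P.toHom (r * w) z ∈ P.arcSet w x j ↔ z ∈ P.arcSet w x j := by
  have hstep (i : ℕ) : z ≡ P.toHom (w ^ i) x [ZMOD n] ↔
      P.toHom w z ≡ P.toHom (w ^ (i + 1)) x [ZMOD n] := by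
    rw [pow_succ_apply, P.modEq_iff]
  have hx : x ∈ P.arcSet w x j := ⟨0, harc.1, by simp [Int.ModEq.refl]⟩
  have hy : y ∉ P.arcSet w x j := fun ⟨i, hi, h⟩ => harc.not_modEq_right hi h.symm
  rw [mul_apply, hr.2.2]
  rcases periodicSwap_cases hr.2.1 (P.toHom w z) with ⟨k, hk, h⟩ | ⟨k, hk, h⟩ | ⟨h1, h2, h⟩
  · rw [h, arcSet_periodic (add_mul_modEq y k)]
    refine iff_of_false hy ?_
    rintro ⟨i, hi, hz⟩
    rw [hstep, hk] at hz
    have hz' := ((add_mul_modEq x k).symm.trans hz).symm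
    rcases Nat.lt_or_ge (i + 1) j with hlt | hge
    · exact harc.2.2.2 (i + 1) (by omega) hlt hz'
    · rw [show i + 1 = j by omega, harc.2.1] at hz'
      exact harc.2.2.1 hz'.symm
  · rw [h, arcSet_periodic (add_mul_modEq x k)]
    refine iff_of_true hx ⟨j - 1, by have := harc.1; omega, ?_⟩
    rw [hstep, Nat.sub_add_cancel harc.1, harc.2.1, hk]
    exact add_mul_modEq y k
  · rw [h]
    constructor
    · rintro ⟨i, hi, hz⟩
      rcases i with _ | i
      · exact absurd (by simpa using hz) h1
      · exact ⟨i, by omega, (hstep i).2 hz⟩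
    · rintro ⟨i, hi, hz⟩
      rw [hstep] at hz
      refine ⟨i + 1, ?_, hz⟩
      rcases Nat.lt_or_ge (i + 1) j with hlt | hge
      · exact hlt
      · rw [show i + 1 = j by omega, harc.2.1] at hz
        exact absurd hz h2

/-- If x is in S then y survives the cut; otherwise the whole orbit of x misses S and nothing is
removed. -/
theorem OrbitArc.sdiff_nonempty {w : W} {x y : ℤ} {j : ℕ} {S : Set ℤ}
    (harc : P.OrbitArc w x y j) (hne : S.Nonempty)
    (hper : ∀ y z : ℤ, y ≡ z [ZMOD n] → y ∈ S → z ∈ S)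
    (hpow : ∀ i x, P.toHom (w ^ i) x ∈ S ↔ x ∈ S) : (S \ P.arcSet w x j).Nonempty := by
  by_cases hx : x ∈ S
  · exact ⟨y, by rw [← harc.2.1]; exact (hpow j x).2 hx,
      fun ⟨i, hi, h⟩ => harc.not_modEq_right hi h.symm⟩
  · obtain ⟨a, ha⟩ := hne
    exact ⟨a, ha, fun ⟨i, hi, h⟩ => hx ((hpow i x).1 (hper _ _ h ha))⟩

theorem ActsAsSwap.apply_mem_iff {r : W} {x y : ℤ} {S : Set ℤ} (hr : P.ActsAsSwap r x y)
    (hper : ∀ y z : ℤ, y ≡ z [ZMOD n] → y ∈ S → z ∈ S) (hxy : x ∈ S ↔ y ∈ S) (z : ℤ) :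
    P.toHom r z ∈ S ↔ z ∈ S := by
  have hadd (x k : ℤ) : x + k * n ∈ S ↔ x ∈ S :=
    ⟨hper _ _ (add_mul_modEq x k), hper _ _ (add_mul_modEq x k).symm⟩
  rw [hr.2.2]
  rcases periodicSwap_cases hr.2.1 z with ⟨k, rfl, h⟩ | ⟨k, rfl, h⟩ | ⟨-, -, h⟩
  · rw [h, hadd, hadd, hxy]
  · rw [h, hadd, hadd, hxy]
  · rw [h]

/-- Cutting off the arc leaves the two drifting cycles with their drifts. For a and b outside the
arc, the height attached to w serves again: it is constant on the arc, which never meets the classes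
of a and b, so inserting r does not affect it. -/
theorem IsAnnular.mul_of_orbitArc {w r : W} {x y : ℤ} {j : ℕ} {U V : Set ℤ}
    (hw : P.IsAnnular w U V) (hr : P.ActsAsSwap r x y) (harc : P.OrbitArc w x y j) :
    P.IsAnnular (r * w) (U \ P.arcSet w x j) (V \ P.arcSet w x j) where
  nonempty_left := harc.sdiff_nonempty hw.nonempty_left hw.periodic_left hw.pow_mem_left_iff
  nonempty_right := harc.sdiff_nonempty hw.nonempty_right hw.periodic_right hw.pow_mem_right_iff
  disjoint z hz hz' := hw.disjoint z hz.1 hz'.1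
  periodic_left y z h hy :=
    ⟨hw.periodic_left y z h hy.1, fun hz => hy.2 ((arcSet_periodic h).2 hz)⟩
  periodic_right y z h hy :=
    ⟨hw.periodic_right y z h hy.1, fun hz => hy.2 ((arcSet_periodic h).2 hz)⟩
  stable_left z := by
    rw [Set.mem_sdiff, harc.mem_arcSet_iff hr, mul_apply,
      hr.apply_mem_iff hw.periodic_left, hw.stable_left, Set.mem_sdiff]
    rw [← harc.2.1, hw.pow_mem_left_iff]
  stable_right z := by
    rw [Set.mem_sdiff, harc.mem_arcSet_iff hr, mul_apply,
      hr.apply_mem_iff hw.periodic_right, hw.stable_right, Set.mem_sdiff]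
    rw [← harc.2.1, hw.pow_mem_right_iff]
  exists_height := by
    rintro a ⟨ha, ha'⟩ b ⟨hb, hb'⟩
    obtain ⟨h, hh, hab, hinv⟩ := hw.exists_height a ha b hb
    have hne : ¬ a ≡ b [ZMOD n] := fun he => hw.disjoint b (hw.periodic_left a b he ha) hb
    have hna (i : ℕ) (hi : i < j) : ¬ P.toHom (w ^ i) x ≡ a [ZMOD n] :=
      fun he => ha' ⟨i, hi, he.symm⟩
    have hnb (i : ℕ) (hi : i < j) : ¬ P.toHom (w ^ i) x ≡ b [ZMOD n] :=
      fun he => hb' ⟨i, hi, he.symm⟩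
    have hpow : ∀ i, i < j → h (P.toHom (w ^ i) x) = h x := by
      intro i
      induction i with
      | zero => simp
      | succ i ih =>
        intro hi
        rw [← ih (by omega), ← hinv (P.toHom (w ^ i) x), ← pow_succ_apply,
          periodicSwap_of_ne (hna _ hi) (hnb _ hi)]
    have hx : h (periodicSwap n a b x) = h x := by
      have h1 := hna 0 harc.1
      have h2 := hnb 0 harc.1
      rw [periodicSwap_of_ne (by simpa using h1) (by simpa using h2)]
    -- y is the image under w of the last point w^(j-1) x of the arc. It may itself be congruent to
    -- a or b, so the swap of a and b cannot be dropped here.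
    have hy : h (periodicSwap n a b y) = h x := by
      rw [← hpow (j - 1) (by have := harc.1; omega), ← hinv (P.toHom (w ^ (j - 1)) x),
        ← pow_succ_apply,
        Nat.sub_add_cancel harc.1, harc.2.1]
    refine ⟨h, hh, hab, fun z => ?_⟩
    rw [mul_apply, hr.2.2, ← hinv z]
    rcases periodicSwap_cases hr.2.1 (P.toHom w z) with ⟨k, hk, h'⟩ | ⟨k, hk, h'⟩ | ⟨-, -, h'⟩
    · rw [h', hk, periodicSwap_add hne, periodicSwap_add hne, height_add_mul hh,
        height_add_mul hh, hx, hy]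
    · rw [h', hk, periodicSwap_add hne, periodicSwap_add hne, height_add_mul hh,
        height_add_mul hh, hx, hy]
    · rw [h']

theorem IsAdmissible.mul_of_orbitArc {w r : W} {x y : ℤ} {j : ℕ} (hw : P.IsAdmissible w)
    (hr : P.ActsAsSwap r x y) (harc : P.OrbitArc w x y j) : P.IsAdmissible (r * w) := by
  rcases hw with hw | ⟨U, V, hw⟩
  · exact Or.inl (hw.mul_of_orbitArc hr harc)
  · exact Or.inr ⟨_, _, hw.mul_of_orbitArc hr harc⟩

theorem ActsAsSwap.mul_mul_cancel {r : W} {x y : ℤ} (hr : P.ActsAsSwap r x y) (w : W) :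
    r * (r * w) = w := by
  rw [← mul_assoc, hr.1.mul_self, one_mul]

theorem mem_invariants_mul {v w : W} {f : ℤ → ℚ} (hv : f ∈ P.invariants v)
    (hw : f ∈ P.invariants w) : f ∈ P.invariants (v * w) :=
  ⟨hv.1, fun z => by rw [mul_apply, hv.2, hw.2]⟩

/-- Since f z = f (w z) for every invariant f of w, no invariant is lost. Since r w fixes z, a
function supported on the class of z is gained. -/
theorem invariants_lt_of_arrow {w r : W} {z : ℤ} (hr : P.ActsAsSwap r z (P.toHom w z)) :
    P.invariants w < P.invariants (r * w) := by
  classical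
  have hn : (n : ℤ) ≠ 0 := by exact_mod_cast P.pos.ne'
  refine lt_of_le_not_ge (fun f hf => mem_invariants_mul
    ((P.mem_invariants_of_actsAsSwap hr hf.1).2 (hf.2 z).symm) hf) fun hle => ?_
  let f : ℤ → ℚ := fun u => if u ≡ z [ZMOD n] then 2 ^ ((u - z) / n) else 0
  have hf1 (u : ℤ) : f (u + n) = 2 * f u := by
    have e : u + n ≡ z [ZMOD n] ↔ u ≡ z [ZMOD n] := by simp [Int.ModEq]
    simp only [f, e]
    split_ifs
    · rw [show u + n - z = u - z + n by ring, Int.add_ediv_of_dvd_right dvd_rfl,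
        Int.ediv_self hn, zpow_add₀ two_ne_zero]
      ring
    · simp
  have hrz : P.toHom (r * w) z = z := by
    rw [mul_apply, hr.2.2, periodicSwap_right_self hr.2.1]
  have hf : f ∈ P.invariants (r * w) := by
    refine ⟨hf1, fun u => ?_⟩
    by_cases hu : u ≡ z [ZMOD n]
    · obtain ⟨k, rfl⟩ := modEq_iff_exists_add.1 hu
      rw [P.map_add_mul, hrz]
    · have hu' : ¬ P.toHom (r * w) u ≡ z [ZMOD n] := by
        intro hc
        exact hu ((P.modEq_iff _).1 (hc.trans (by rw [hrz])))
      simp only [f, if_neg hu, if_neg hu']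
  have := (hle hf).2 z
  simp only [f, if_neg (not_modEq_symm hr.2.1), if_pos (Int.ModEq.refl z)] at this
  simp at this

theorem mem_invariants_pow {w : W} {f : ℤ → ℚ} (hf : f ∈ P.invariants w) (i : ℕ) (x : ℤ) :
    f (P.toHom (w ^ i) x) = f x := by
  induction i with
  | zero => simp
  | succ i ih => rw [pow_succ_apply, hf.2, ih]

theorem IsAnnular.not_modEq {w : W} {U V : Set ℤ} (hw : P.IsAnnular w U V) {a b : ℤ}
    (ha : a ∈ U) (hb : b ∈ V) : ¬ a ≡ b [ZMOD n] :=
  fun he => hw.disjoint b (hw.periodic_left a b he ha) hb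

/-- The height is constant along an orbit as long as the two marked classes are not met. -/
theorem height_pow {w : W} {h : ℤ → ℤ} {a b x : ℤ}
    (hinv : ∀ z, h (periodicSwap n a b (P.toHom w z)) = h z) {j : ℕ}
    (hne : ∀ i, 0 < i → i ≤ j →
      ¬ P.toHom (w ^ i) x ≡ a [ZMOD n] ∧ ¬ P.toHom (w ^ i) x ≡ b [ZMOD n]) :
    h (P.toHom (w ^ j) x) = h x := by
  induction j with
  | zero => simp
  | succ j ih =>
    rw [← ih fun i h1 h2 => hne i h1 (by omega), ← hinv (P.toHom (w ^ j) x), ← pow_succ_apply,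
      periodicSwap_of_ne (hne _ (by omega) le_rfl).1 (hne _ (by omega) le_rfl).2]

/-- The orbit of a stays in U, so it returns to the class of a without meeting that of b. The height
is constant until the last step, which raises it by exactly 1. -/
theorem IsAnnular.exists_pow_left {w : W} {U V : Set ℤ} (hw : P.IsAnnular w U V) {a : ℤ}
    (ha : a ∈ U) : ∃ j, P.toHom (w ^ j) a = a + n := by
  obtain ⟨b, hb⟩ := hw.nonempty_right
  have hne := hw.not_modEq ha hb
  obtain ⟨h, hh, hab, hinv⟩ := hw.exists_height a ha b hb
  obtain ⟨j, hj, hret, hmin⟩ := P.exists_first_return w a b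
  have hret' : P.toHom (w ^ j) a ≡ a [ZMOD n] := by
    rcases hret with hret | hret
    · exact hret
    · exact absurd hret (hw.not_modEq ((hw.pow_mem_left_iff j a).2 ha) hb)
  obtain ⟨k, hk⟩ := modEq_iff_exists_add.1 hret'
  have h1 := height_pow hinv (j := j - 1) (x := a) fun i hi hij => hmin i hi (by omega)
  rw [← hinv, ← pow_succ_apply, Nat.sub_add_cancel hj, hk, periodicSwap_left,
    height_add_mul hh] at h1
  refine ⟨j, ?_⟩
  rw [hk, show k = 1 by linarith, one_mul]

theorem IsAnnular.exists_pow_right {w : W} {U V : Set ℤ} (hw : P.IsAnnular w U V) {b : ℤ}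
    (hb : b ∈ V) : ∃ j, P.toHom (w ^ j) b = b + (-1 : ℤ) * n := by
  obtain ⟨a, ha⟩ := hw.nonempty_left
  have hne := hw.not_modEq ha hb
  obtain ⟨h, hh, hab, hinv⟩ := hw.exists_height a ha b hb
  obtain ⟨j, hj, hret, hmin⟩ := P.exists_first_return w b a
  have hret' : P.toHom (w ^ j) b ≡ b [ZMOD n] := by
    rcases hret with hret | hret
    · exact hret
    · exact absurd hret.symm (hw.not_modEq ha ((hw.pow_mem_right_iff j b).2 hb))
  obtain ⟨k, hk⟩ := modEq_iff_exists_add.1 hret'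
  have h1 := height_pow hinv (j := j - 1) (x := b) fun i hi hij => (hmin i hi (by omega)).symm
  rw [← hinv, ← pow_succ_apply, Nat.sub_add_cancel hj, hk, periodicSwap_right hne,
    height_add_mul hh] at h1
  refine ⟨j, ?_⟩
  rw [hk, show k = -1 by linarith]

/-- An invariant f of w satisfies f a = f (a + n) = 2 f a, so f a = 0, and likewise f b = 0; thus r
fixes f. The new invariant of r w is 2^h, which vanishes nowhere. -/
theorem IsAnnular.invariants_lt {w r : W} {U V : Set ℤ} (hw : P.IsAnnular w U V) {a b : ℤ}
    (ha : a ∈ U) (hb : b ∈ V) (hr : P.ActsAsSwap r a b) :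
    P.invariants w < P.invariants (r * w) := by
  have h0 : ∀ f ∈ P.invariants w, f a = 0 ∧ f b = 0 := by
    intro f hf
    obtain ⟨i, hi⟩ := hw.exists_pow_left ha
    obtain ⟨j, hj⟩ := hw.exists_pow_right hb
    have h1 := mem_invariants_pow hf i a
    have h2 := mem_invariants_pow hf j b
    rw [hi, hf.1] at h1
    rw [hj, quasiperiodic_add_mul hf.1] at h2
    refine ⟨by linarith, ?_⟩
    norm_num at h2
    linarith
  obtain ⟨h, hh, hab, hinv⟩ := hw.exists_height a ha b hb
  refine lt_of_le_not_ge (fun f hf => mem_invariants_mul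
    ((P.mem_invariants_of_actsAsSwap hr hf.1).2 (by rw [(h0 f hf).1, (h0 f hf).2])) hf)
    fun hle => ?_
  have hf : (fun z => (2 : ℚ) ^ h z) ∈ P.invariants (r * w) := by
    refine ⟨fun z => ?_, fun z => ?_⟩
    · simp only [hh, zpow_add₀ (two_ne_zero (α := ℚ))]; ring
    · simp only [mul_apply, hr.2.2, hinv]
  exact zpow_ne_zero _ two_ne_zero (h0 _ (hle hf)).1

theorem IsAnnular.isElliptic_mul {w r : W} {U V : Set ℤ} (hw : P.IsAnnular w U V) {a b : ℤ}
    (ha : a ∈ U) (hb : b ∈ V) (hr : P.ActsAsSwap r a b) : P.IsElliptic (r * w) := by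
  obtain ⟨h, hh, -, hinv⟩ := hw.exists_height a ha b hb
  exact ⟨h, hh, fun z => by rw [mul_apply, hr.2.2, hinv]⟩

theorem orbitArc_one {w : W} {z : ℤ} (h : ¬ z ≡ P.toHom w z [ZMOD n]) :
    P.OrbitArc w z (P.toHom w z) 1 :=
  ⟨one_pos, by simp, h, fun i h1 h2 => by omega⟩

theorem reflLength_le_mul_add_one {r : W} (hr : cs.IsReflection r) (w : W) :
    reflLength cs w ≤ reflLength cs (r * w) + 1 := by
  have h1 := reflLength_mul_le cs r (r * w)
  rw [← mul_assoc, hr.mul_self, one_mul, reflLength_eq_one cs hr] at h1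
  omega

theorem IsElliptic.not_modEq {w : W} (hw : P.IsElliptic w) {z : ℤ} (hz : P.toHom w z ≠ z) :
    ¬ z ≡ P.toHom w z [ZMOD n] := by
  obtain ⟨h, hh, hinv⟩ := hw
  intro hc
  obtain ⟨k, hk⟩ := modEq_iff_exists_add.1 hc.symm
  have h1 := hinv z
  rw [hk, height_add_mul hh] at h1
  apply hz
  rw [hk, show k = 0 by linarith]
  ring

/-- Each letter (z, w z) keeps w elliptic and lowers the corank, so removing such letters reaches 1
in at most corank many steps. -/
theorem IsElliptic.reflLength_le {w : W} (hw : P.IsElliptic w) :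
    reflLength cs w ≤ P.corank w := by
  induction hk : P.corank w using Nat.strong_induction_on generalizing w with
  | _ k ih =>
    by_cases h1 : w = 1
    · rw [h1, reflLength_one]; exact Nat.zero_le _
    · obtain ⟨z, hz⟩ : ∃ z, P.toHom w z ≠ z := by
        by_contra! hc
        exact h1 (P.ext fun z => by simpa using hc z)
      have hne := hw.not_modEq hz
      obtain ⟨r, hr⟩ := P.exists_reflection_actsAsSwap hne
      have h2 := P.corank_lt_of_invariants_lt (invariants_lt_of_arrow hr)
      have h3 := ih _ (hk ▸ h2) (hw.mul_of_orbitArc hr (orbitArc_one hne)) rfl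
      have h4 := reflLength_le_mul_add_one hr.1 w
      omega

/-- In the annular case one crossing letter (a b) makes the element elliptic and lowers the corank,
so the elliptic bound carries over. -/
theorem IsAdmissible.reflLength_eq {w : W} (hw : P.IsAdmissible w) :
    reflLength cs w = P.corank w := by
  refine le_antisymm ?_ (P.corank_le_reflLength w)
  rcases hw with hw | ⟨U, V, hw⟩
  · exact hw.reflLength_le
  · obtain ⟨a, ha⟩ := hw.nonempty_left
    obtain ⟨b, hb⟩ := hw.nonempty_right
    obtain ⟨r, hr⟩ := P.exists_reflection_actsAsSwap (hw.not_modEq ha hb)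
    have h1 := (hw.isElliptic_mul ha hb hr).reflLength_le
    have h2 := P.corank_lt_of_invariants_lt (hw.invariants_lt ha hb hr)
    have h3 := reflLength_le_mul_add_one hr.1 w
    omega

end PeriodicModel

/-! ### First letters of reduced factorizations and their connectivity -/

/-- `r` is a reflection occurring as first letter of a reduced reflection factorization of `w`. -/
def IsFirstLetter {B W : Type*} [Group W] {M : CoxeterMatrix B} (cs : CoxeterSystem M W)
    (w r : W) : Prop :=
  cs.IsReflection r ∧ reflLength cs (r * w) < reflLength cs w

/-- `r` and `t` are the first two letters of a reduced reflection factorization of `w`. -/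
def AreFirstLetters {B W : Type*} [Group W] {M : CoxeterMatrix B} (cs : CoxeterSystem M W)
    (w r t : W) : Prop :=
  IsFirstLetter cs w r ∧ IsFirstLetter cs (r * w) t

namespace PeriodicModel

variable {B W : Type*} [Group W] {M : CoxeterMatrix B} {cs : CoxeterSystem M W} {n : ℕ}
  {P : PeriodicModel cs n}

/-- If `f` is invariant under `r w`, then it is constant along `w`-orbits away from the two
classes moved by `r`. -/
theorem invariant_pow {w r : W} {x y u : ℤ} (hr : P.ActsAsSwap r x y) {f : ℤ → ℚ}
    (hf : f ∈ P.invariants (r * w)) {j : ℕ}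
    (hne : ∀ i, 0 < i → i ≤ j →
      ¬ P.toHom (w ^ i) u ≡ x [ZMOD n] ∧ ¬ P.toHom (w ^ i) u ≡ y [ZMOD n]) :
    f (P.toHom (w ^ j) u) = f u := by
  induction j with
  | zero => simp
  | succ j ih =>
    rw [← ih fun i h1 h2 => hne i h1 (by omega), ← hf.2 (P.toHom (w ^ j) u), mul_apply,
      ← pow_succ_apply, hr.2.2,
      periodicSwap_of_ne (hne _ (by omega) le_rfl).1 (hne _ (by omega) le_rfl).2]

theorem invariant_return {w r : W} {x y u : ℤ} (hr : P.ActsAsSwap r x y) {f : ℤ → ℚ}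
    (hf : f ∈ P.invariants (r * w)) {j : ℕ} (hj : 0 < j)
    (hne : ∀ i, 0 < i → i < j →
      ¬ P.toHom (w ^ i) u ≡ x [ZMOD n] ∧ ¬ P.toHom (w ^ i) u ≡ y [ZMOD n]) :
    f (periodicSwap n x y (P.toHom (w ^ j) u)) = f u := by
  rw [← invariant_pow hr hf (j := j - 1) (u := u) fun i h1 h2 => hne i h1 (by omega),
    ← hf.2 (P.toHom (w ^ (j - 1)) u), mul_apply, ← pow_succ_apply, hr.2.2,
    Nat.sub_add_cancel hj]

/-- Follow x and y under w to their first return to the classes of x and y. If both come back to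
their own class, zero drift would give f x = f y. If each reaches the other, a zero shift gives an
arc, and two nonzero shifts force f x = f y = 0. -/
theorem orbitArc_or_drifts {w r : W} {x y : ℤ} (hr : P.ActsAsSwap r x y) {f : ℤ → ℚ}
    (hf : f ∈ P.invariants (r * w)) (hxy : f x ≠ f y) :
    (∃ j, P.OrbitArc w x y j) ∨ (∃ j, P.OrbitArc w y x j) ∨
      (P.Drifts w x y ∧ P.Drifts w y x) := by
  have hne := hr.2.1
  obtain ⟨j, hj, hjr, hjm⟩ := P.exists_first_return w x y
  obtain ⟨i, hi, hir, him⟩ := P.exists_first_return w y x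
  have hfx := invariant_return hr hf hj hjm
  have hfy := invariant_return hr hf hi fun k h1 h2 => (him k h1 h2).symm
  rcases hjr with hjr | hjr <;> rcases hir with hir | hir <;>
    obtain ⟨k, hk⟩ := modEq_iff_exists_add.1 hjr <;>
    obtain ⟨l, hl⟩ := modEq_iff_exists_add.1 hir
  · rw [hk, periodicSwap_left, quasiperiodic_add_mul hf.1] at hfx
    rw [hl, periodicSwap_right hne, quasiperiodic_add_mul hf.1] at hfy
    refine Or.inr (Or.inr ⟨⟨j, k, ?_, hk, fun m h1 h2 => ?_⟩, ⟨i, l, ?_, hl, fun m h1 h2 => ?_⟩⟩)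
    · rintro rfl
      exact hxy (by simpa using hfx.symm)
    · rcases h2.lt_or_eq with h2 | rfl
      · exact (hjm m h1 h2).2
      · exact fun hc => hne (hjr.symm.trans hc)
    · rintro rfl
      exact hxy (by simpa using hfy)
    · rcases h2.lt_or_eq with h2 | rfl
      · exact (him m h1 h2).2
      · exact fun hc => hne (hc.symm.trans hir)
  -- Here both orbits first enter the same class; running back from it, one of them must already
  -- have met the other's starting class.
  · exfalso
    rcases lt_trichotomy i j with h | rfl | h
    · obtain ⟨m, rfl⟩ := Nat.exists_eq_add_of_lt h
      exact (hjm (m + 1) (by omega) (by omega)).2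
        (modEq_of_pow_modEq (i := i) w (by rw [← add_assoc]; exact hjr.trans hir.symm))
    · exact hne ((P.modEq_iff _).1 (hjr.trans hir.symm))
    · obtain ⟨m, rfl⟩ := Nat.exists_eq_add_of_lt h
      exact (him (m + 1) (by omega) (by omega)).2
        (modEq_of_pow_modEq (i := j) w (by rw [← add_assoc]; exact hir.trans hjr.symm))
  · exfalso
    rcases lt_trichotomy i j with h | rfl | h
    · obtain ⟨m, rfl⟩ := Nat.exists_eq_add_of_lt h
      exact (hjm (m + 1) (by omega) (by omega)).2
        (modEq_of_pow_modEq (i := i) w (by rw [← add_assoc]; exact hjr.trans hir.symm))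
    · exact hne ((P.modEq_iff _).1 (hjr.trans hir.symm))
    · obtain ⟨m, rfl⟩ := Nat.exists_eq_add_of_lt h
      exact (him (m + 1) (by omega) (by omega)).2
        (modEq_of_pow_modEq (i := j) w (by rw [← add_assoc]; exact hir.trans hjr.symm))
  · rw [hk, periodicSwap_right hne, quasiperiodic_add_mul hf.1] at hfx
    rw [hl, periodicSwap_left, quasiperiodic_add_mul hf.1] at hfy
    by_cases hk0 : k = 0
    · subst hk0
      exact Or.inl ⟨j, hj, by simpa using hk, hne, fun m h1 h2 => (hjm m h1 h2).1⟩
    by_cases hl0 : l = 0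
    · subst hl0
      exact Or.inr (Or.inl ⟨i, hi, by simpa using hl, not_modEq_symm hne,
        fun m h1 h2 => (him m h1 h2).1⟩)
    exfalso
    have hpow (k : ℤ) (hk0 : k ≠ 0) : (2 : ℚ) ^ k ≠ 1 := by
      intro h
      exact hk0 ((zpow_eq_one_iff_right₀ (by norm_num) (by norm_num)).1 h)
    have h1 : f x = 0 := by
      have : ((2 : ℚ) ^ k - 1) * f x = 0 := by rw [sub_mul, hfx]; ring
      exact (mul_eq_zero.1 this).resolve_left (sub_ne_zero.2 (hpow k hk0))
    have h2 : f y = 0 := by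
      have : ((2 : ℚ) ^ l - 1) * f y = 0 := by rw [sub_mul, hfy]; ring
      exact (mul_eq_zero.1 this).resolve_left (sub_ne_zero.2 (hpow l hl0))
    exact hxy (h1.trans h2.symm)

/-- For admissible w length equals corank, and corank bounds the length of r w from below, so r w
has an invariant that w lacks. Such an f separates x from y. -/
theorem IsFirstLetter.orbitArc_or_drifts {w r : W} (hw : P.IsAdmissible w)
    (hr : IsFirstLetter cs w r) :
    (∃ x y j, P.ActsAsSwap r x y ∧ P.OrbitArc w x y j) ∨
      (∃ x y, P.ActsAsSwap r x y ∧ P.Drifts w x y ∧ P.Drifts w y x) := by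
  obtain ⟨x, y, hxy⟩ := P.exists_actsAsSwap hr.1
  have h1 := hr.2
  rw [hw.reflLength_eq] at h1
  have h2 := (P.corank_le_reflLength (r * w)).trans_lt h1
  obtain ⟨f, hf, hfw⟩ : ∃ f ∈ P.invariants (r * w), f ∉ P.invariants w := by
    by_contra! hc
    have h3 := Submodule.finrank_mono (R := ℚ) (fun f hf => hc f hf :
      P.invariants (r * w) ≤ P.invariants w)
    unfold corank at h2
    omega
  have hne : f x ≠ f y := by
    intro he
    apply hfw
    rw [← hxy.mul_mul_cancel w]
    exact mem_invariants_mul ((P.mem_invariants_of_actsAsSwap hxy hf.1).2 he) hf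
  rcases PeriodicModel.orbitArc_or_drifts hxy hf hne with ⟨j, h⟩ | ⟨j, h⟩ | h
  · exact Or.inl ⟨x, y, j, hxy, h⟩
  · exact Or.inl ⟨y, x, j, hxy.symm, h⟩
  · exact Or.inr ⟨x, y, hxy, h⟩

theorem IsElliptic.not_drifts {w : W} (hw : P.IsElliptic w) {x y : ℤ} : ¬ P.Drifts w x y := by
  rintro ⟨j, k, hk, hj, -⟩
  obtain ⟨h, hh, hinv⟩ := hw
  have hpow : ∀ i, h (P.toHom (w ^ i) x) = h x := by
    intro i
    induction i with
    | zero => simp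
    | succ i ih => rw [pow_succ_apply, hinv, ih]
  have h1 := hpow j
  rw [hj, height_add_mul hh] at h1
  exact hk (by linarith)

/-- The height attached to a and b can change only in their classes, so an orbit avoiding both
cannot drift. -/
theorem IsAnnular.not_drifts_of_avoids {w : W} {U V : Set ℤ} (hw : P.IsAnnular w U V)
    {a b x : ℤ} (ha : a ∈ U) (hb : b ∈ V) {j : ℕ} {k : ℤ} (hk : k ≠ 0)
    (hj : P.toHom (w ^ j) x = x + k * n)
    (hne : ∀ i, 0 < i → i ≤ j →
      ¬ P.toHom (w ^ i) x ≡ a [ZMOD n] ∧ ¬ P.toHom (w ^ i) x ≡ b [ZMOD n]) : False := by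
  obtain ⟨h, hh, -, hinv⟩ := hw.exists_height a ha b hb
  have h1 := height_pow hinv hne
  rw [hj, height_add_mul hh] at h1
  exact hk (by linarith)

theorem IsAnnular.mem_or_mem_of_drifts {w : W} {U V : Set ℤ} (hw : P.IsAnnular w U V) {x y : ℤ}
    (h : P.Drifts w x y) : x ∈ U ∨ x ∈ V := by
  by_contra! hc
  obtain ⟨a, ha⟩ := hw.nonempty_left
  obtain ⟨b, hb⟩ := hw.nonempty_right
  obtain ⟨j, k, hk, hj, -⟩ := h
  exact hw.not_drifts_of_avoids ha hb hk hj fun i _ _ =>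
    ⟨fun he => hc.1 ((hw.pow_mem_left_iff i x).1 (hw.periodic_left _ _ he.symm ha)),
      fun he => hc.2 ((hw.pow_mem_right_iff i x).1 (hw.periodic_right _ _ he.symm hb))⟩

/-- Two drifting points in U cannot avoid each other, because U is a single cycle; the same holds
for V. So they lie on opposite sides. -/
theorem IsAnnular.mem_of_drifts {w : W} {U V : Set ℤ} (hw : P.IsAnnular w U V) {x y : ℤ}
    (hx : P.Drifts w x y) (hy : P.Drifts w y x) : x ∈ U ∧ y ∈ V ∨ y ∈ U ∧ x ∈ V := by
  rcases hw.mem_or_mem_of_drifts hx with h1 | h1 <;> rcases hw.mem_or_mem_of_drifts hy with h2 | h2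
  · exfalso
    obtain ⟨b, hb⟩ := hw.nonempty_right
    obtain ⟨j, k, hk, hj, hne⟩ := hy
    exact hw.not_drifts_of_avoids h1 hb hk hj fun i hi hi' =>
      ⟨hne i hi hi', hw.not_modEq ((hw.pow_mem_left_iff i y).2 h2) hb⟩
  · exact Or.inl ⟨h1, h2⟩
  · exact Or.inr ⟨h2, h1⟩
  · exfalso
    obtain ⟨a, ha⟩ := hw.nonempty_left
    obtain ⟨j, k, hk, hj, hne⟩ := hy
    exact hw.not_drifts_of_avoids ha h1 hk hj fun i hi hi' =>
      ⟨not_modEq_symm (hw.not_modEq ha ((hw.pow_mem_right_iff i y).2 h2)), hne i hi hi'⟩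

theorem IsFirstLetter.orbitArc_of_isElliptic {w r : W} (hw : P.IsElliptic w)
    (hr : IsFirstLetter cs w r) : ∃ x y j, P.ActsAsSwap r x y ∧ P.OrbitArc w x y j := by
  rcases IsFirstLetter.orbitArc_or_drifts (Or.inl hw) hr with h | ⟨x, y, -, h, -⟩
  · exact h
  · exact absurd h hw.not_drifts

theorem IsFirstLetter.orbitArc_or_mem {w r : W} {U V : Set ℤ} (hw : P.IsAnnular w U V)
    (hr : IsFirstLetter cs w r) :
    (∃ x y j, P.ActsAsSwap r x y ∧ P.OrbitArc w x y j) ∨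
      ∃ a b, P.ActsAsSwap r a b ∧ a ∈ U ∧ b ∈ V := by
  rcases IsFirstLetter.orbitArc_or_drifts (Or.inr ⟨U, V, hw⟩) hr with h | ⟨x, y, h, h1, h2⟩
  · exact Or.inl h
  · rcases hw.mem_of_drifts h1 h2 with h3 | h3
    · exact Or.inr ⟨x, y, h, h3⟩
    · exact Or.inr ⟨y, x, h.symm, h3⟩

theorem IsAdmissible.mul_of_isFirstLetter {w r : W} (hw : P.IsAdmissible w)
    (hr : IsFirstLetter cs w r) : P.IsAdmissible (r * w) := by
  rcases IsFirstLetter.orbitArc_or_drifts hw hr with ⟨x, y, j, h1, h2⟩ | ⟨x, y, h, h1, h2⟩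
  · exact hw.mul_of_orbitArc h1 h2
  · rcases hw with hw | ⟨U, V, hw⟩
    · exact absurd h1 hw.not_drifts
    · rcases hw.mem_of_drifts h1 h2 with h3 | h3
      · exact Or.inl (hw.isElliptic_mul h3.1 h3.2 h)
      · exact Or.inl (hw.isElliptic_mul h3.1 h3.2 h.symm)

theorem IsAdmissible.isFirstLetter_of_lt {w r : W} (hw : P.IsAdmissible w)
    (hr : cs.IsReflection r) (hrw : P.IsAdmissible (r * w))
    (hlt : P.invariants w < P.invariants (r * w)) : IsFirstLetter cs w r :=
  ⟨hr, by rw [hw.reflLength_eq, hrw.reflLength_eq]; exact P.corank_lt_of_invariants_lt hlt⟩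

theorem IsAdmissible.isFirstLetter_arrow {w r : W} {z : ℤ} (hw : P.IsAdmissible w)
    (hr : P.ActsAsSwap r z (P.toHom w z)) : IsFirstLetter cs w r :=
  hw.isFirstLetter_of_lt hr.1 (hw.mul_of_orbitArc hr (orbitArc_one hr.2.1))
    (invariants_lt_of_arrow hr)

theorem IsAnnular.isFirstLetter {w r : W} {U V : Set ℤ} (hw : P.IsAnnular w U V) {a b : ℤ}
    (ha : a ∈ U) (hb : b ∈ V) (hr : P.ActsAsSwap r a b) : IsFirstLetter cs w r :=
  IsAdmissible.isFirstLetter_of_lt (Or.inr ⟨U, V, hw⟩) hr.1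
    (Or.inl (hw.isElliptic_mul ha hb hr)) (hw.invariants_lt ha hb hr)

/-- When r does not move w z, the step from z to w z is also a step of r w, so t remains available
as the next letter. -/
theorem IsAdmissible.areFirstLetters_arrow {w r t : W} {x y z : ℤ} (hw : P.IsAdmissible w)
    (hr : IsFirstLetter cs w r) (hxy : P.ActsAsSwap r x y)
    (ht : P.ActsAsSwap t z (P.toHom w z)) (hx : ¬ P.toHom w z ≡ x [ZMOD n])
    (hy : ¬ P.toHom w z ≡ y [ZMOD n]) : AreFirstLetters cs w r t := by
  refine ⟨hr, (hw.mul_of_isFirstLetter hr).isFirstLetter_arrow (z := z) ?_⟩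
  rwa [mul_apply, hxy.2.2, periodicSwap_of_ne hx hy]

theorem IsAdmissible.connected_arrow {w r : W} {x y : ℤ} {j : ℕ} (hw : P.IsAdmissible w)
    (hr : IsFirstLetter cs w r) (hxy : P.ActsAsSwap r x y) (harc : P.OrbitArc w x y j) :
    ∃ t, P.ActsAsSwap t x (P.toHom w x) ∧ Relation.EqvGen (AreFirstLetters cs w) r t := by
  rcases Nat.lt_or_ge 1 j with h1 | h1
  · have hx : ¬ P.toHom w x ≡ x [ZMOD n] := by simpa using harc.2.2.2 1 one_pos h1
    have hy : ¬ P.toHom w x ≡ y [ZMOD n] := by simpa using harc.not_modEq_right h1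
    obtain ⟨t, ht⟩ := P.exists_reflection_actsAsSwap (not_modEq_symm hx)
    exact ⟨t, ht, .rel _ _ (hw.areFirstLetters_arrow hr hxy ht hx hy)⟩
  · have hj : j = 1 := le_antisymm h1 harc.1
    subst hj
    have : P.toHom w x = y := by simpa using harc.2.1
    exact ⟨r, by rwa [this], .refl _⟩

/-- An edge from r to t is available unless w z ≡ x, and one from t to r unless w x ≡ z. -/
theorem IsElliptic.connected_arrows {w r t : W} {x z : ℤ} (hw : P.IsElliptic w)
    (hr : P.ActsAsSwap r x (P.toHom w x)) (ht : P.ActsAsSwap t z (P.toHom w z)) :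
    Relation.EqvGen (AreFirstLetters cs w) r t := by
  have hw' : P.IsAdmissible w := Or.inl hw
  by_cases hxz : x ≡ z [ZMOD n]
  · obtain ⟨k, rfl⟩ := modEq_iff_exists_add.1 hxz.symm
    rw [P.map_add_mul] at ht
    rw [hr.eq_of_shift k ht]
    exact .refl _
  by_cases h1 : P.toHom w z ≡ x [ZMOD n]
  · by_cases h2 : P.toHom w x ≡ z [ZMOD n]
    -- x and z now form a 2-cycle mod n; zero drift makes the two shifts opposite, so r and t are
    -- the same reflection.
    · obtain ⟨h, hh, hinv⟩ := hw
      obtain ⟨k, hk⟩ := modEq_iff_exists_add.1 h1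
      obtain ⟨l, hl⟩ := modEq_iff_exists_add.1 h2
      have h3 := hinv z
      have h4 := hinv x
      rw [hk, height_add_mul hh] at h3
      rw [hl, height_add_mul hh] at h4
      have hkl : l = -k := by linarith
      subst hkl
      rw [hk] at ht
      rw [hl] at hr
      rw [hr.symm.eq_of_shift k (t := t) (by simpa using ht)]
      exact .refl _
    · exact .symm _ _ (.rel _ _ (hw'.areFirstLetters_arrow (hw'.isFirstLetter_arrow ht) ht hr h2
        fun h => hxz ((P.modEq_iff w).1 h)))
  · exact .rel _ _ (hw'.areFirstLetters_arrow (hw'.isFirstLetter_arrow hr) hr ht h1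
      fun h => hxz ((P.modEq_iff w).1 h).symm)

theorem IsElliptic.connected {w r t : W} (hw : P.IsElliptic w) (hr : IsFirstLetter cs w r)
    (ht : IsFirstLetter cs w t) : Relation.EqvGen (AreFirstLetters cs w) r t := by
  obtain ⟨x, y, j, hxy, harc⟩ := IsFirstLetter.orbitArc_of_isElliptic hw hr
  obtain ⟨x', y', j', hxy', harc'⟩ := IsFirstLetter.orbitArc_of_isElliptic hw ht
  obtain ⟨u, hu, h⟩ := IsAdmissible.connected_arrow (Or.inl hw) hr hxy harc
  obtain ⟨u', hu', h'⟩ := IsAdmissible.connected_arrow (Or.inl hw) ht hxy' harc'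
  exact h.trans _ _ _ ((hw.connected_arrows hu hu').trans _ _ _ (h'.symm _ _))

/-- If r does not move w z, then t can follow r. If w z ≡ a or b, then z itself is congruent to
neither; cutting off the class of z by t leaves a and b on the drifting cycles, so r can follow t.
-/
theorem IsAnnular.connected_arrow {w r t : W} {U V : Set ℤ} (hw : P.IsAnnular w U V) {a b z : ℤ}
    (ha : a ∈ U) (hb : b ∈ V) (hr : P.ActsAsSwap r a b)
    (ht : P.ActsAsSwap t z (P.toHom w z)) : Relation.EqvGen (AreFirstLetters cs w) r t := by
  have hw' : P.IsAdmissible w := Or.inr ⟨U, V, hw⟩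
  by_cases h : P.toHom w z ≡ a [ZMOD n] ∨ P.toHom w z ≡ b [ZMOD n]
  · have h1 : ¬ a ≡ z [ZMOD n] := by
      intro he
      rcases h with h | h
      · exact ht.2.1 (he.symm.trans h.symm)
      · exact hw.not_modEq ((hw.stable_left z).2 (hw.periodic_left _ _ he ha)) hb h
    have h2 : ¬ b ≡ z [ZMOD n] := by
      intro he
      rcases h with h | h
      · exact hw.not_modEq ha ((hw.stable_right z).2 (hw.periodic_right _ _ he hb)) h.symm
      · exact ht.2.1 (he.symm.trans h.symm)
    refine .symm _ _ (.rel _ _ ⟨hw'.isFirstLetter_arrow ht,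
      (hw.mul_of_orbitArc ht (orbitArc_one ht.2.1)).isFirstLetter ⟨ha, ?_⟩ ⟨hb, ?_⟩ hr⟩)
    · rintro ⟨i, hi, h⟩
      obtain rfl : i = 0 := by omega
      exact h1 (by simpa using h)
    · rintro ⟨i, hi, h⟩
      obtain rfl : i = 0 := by omega
      exact h2 (by simpa using h)
  · push Not at h
    exact .rel _ _ (hw'.areFirstLetters_arrow (hw.isFirstLetter ha hb hr) hr ht h.1 h.2)

/-- Every class is preserved, so U and V are single classes, shifted by n and -n, and the crossing
letters are the swaps (a, b + k n). -/
theorem IsAnnular.connected_of_no_arrow {w : W} {U V : Set ℤ} (hw : P.IsAnnular w U V)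
    (hno : ∀ z, z ≡ P.toHom w z [ZMOD n]) {r t : W} {a b a' b' : ℤ} (ha : a ∈ U) (hb : b ∈ V)
    (hr : P.ActsAsSwap r a b) (ha' : a' ∈ U) (hb' : b' ∈ V) (ht : P.ActsAsSwap t a' b') :
    Relation.EqvGen (AreFirstLetters cs w) r t := by
  have hpow (x : ℤ) (i : ℕ) : P.toHom (w ^ i) x ≡ x [ZMOD n] := by
    induction i with
    | zero => simp [Int.ModEq.refl]
    | succ i ih => rw [pow_succ_apply]; exact (hno _).symm.trans ih
  have heq (x y : ℤ) (hx : x ∈ U) (hy : y ∈ U) : y ≡ x [ZMOD n] := by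
    by_contra hne
    obtain ⟨j, hj⟩ := hw.exists_pow_left hy
    exact hw.not_drifts_of_avoids hx hb one_ne_zero (by rw [hj, one_mul]) fun i _ _ =>
      ⟨fun h => hne ((hpow y i).symm.trans h),
        hw.not_modEq ((hw.pow_mem_left_iff i y).2 hy) hb⟩
  have heq' (x y : ℤ) (hx : x ∈ V) (hy : y ∈ V) : y ≡ x [ZMOD n] := by
    by_contra hne
    obtain ⟨j, hj⟩ := hw.exists_pow_right hy
    exact hw.not_drifts_of_avoids ha hx (by norm_num) hj fun i _ _ =>
      ⟨not_modEq_symm (hw.not_modEq ha ((hw.pow_mem_right_iff i y).2 hy)),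
        fun h => hne ((hpow y i).symm.trans h)⟩
  -- For r = (a b), r w sends a to r (a + n) = b + n, so (a, b + n) can follow r.
  have hstep {b : ℤ} (hb : b ∈ V) {r t : W} (hr : P.ActsAsSwap r a b)
      (ht : P.ActsAsSwap t a (b + n)) : AreFirstLetters cs w r t := by
    refine ⟨hw.isFirstLetter ha hb hr,
      IsAdmissible.isFirstLetter_arrow (Or.inl (hw.isElliptic_mul ha hb hr)) (z := a) ?_⟩
    obtain ⟨h, hh, hab, hinv⟩ := hw.exists_height a ha b hb
    obtain ⟨k, hk⟩ := modEq_iff_exists_add.1 (hno a).symm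
    have h1 := hinv a
    rw [hk, periodicSwap_left, height_add_mul hh] at h1
    rwa [mul_apply, hr.2.2, hk, periodicSwap_left, show k = 1 by linarith, one_mul]
  have hmem (k : ℤ) : b + k * n ∈ V := hw.periodic_right _ _ (add_mul_modEq b k).symm hb
  have hex (k : ℤ) : ∃ t, P.ActsAsSwap t a (b + k * n) :=
    P.exists_reflection_actsAsSwap (hw.not_modEq ha (hmem k))
  choose u hu using hex
  have hchain (k : ℤ) : Relation.EqvGen (AreFirstLetters cs w) (u 0) (u k) := by
    have hs (k : ℤ) : AreFirstLetters cs w (u k) (u (k + 1)) := by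
      refine hstep (hmem k) (hu k) ?_
      have := hu (k + 1)
      rwa [show b + (k + 1) * n = b + k * n + n by ring] at this
    induction k using Int.induction_on with
    | zero => exact .refl _
    | succ i ih => exact ih.trans _ _ _ (.rel _ _ (hs _))
    | pred i ih =>
      refine ih.trans _ _ _ (.symm _ _ (.rel _ _ ?_))
      have := hs (-i - 1)
      rwa [sub_add_cancel] at this
  have h0 : r = u 0 := hr.unique (by simpa using hu 0)
  obtain ⟨k, hk⟩ := modEq_iff_exists_add.1 (heq a a' ha ha')
  obtain ⟨l, hl⟩ := modEq_iff_exists_add.1 (heq' b b' hb hb')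
  -- Translating (a', b') by -k n puts it in the form (a, b + (l - k) n).
  have h1 : u (l - k) = t := by
    refine (hu (l - k)).eq_of_shift k ?_
    rwa [← hk, show b + (l - k) * n + k * n = b' by rw [hl]; ring]
  rw [h0, ← h1]
  exact hchain _

theorem IsAnnular.connected {w r t : W} {U V : Set ℤ} (hw : P.IsAnnular w U V)
    (hr : IsFirstLetter cs w r) (ht : IsFirstLetter cs w t) :
    Relation.EqvGen (AreFirstLetters cs w) r t := by
  have hw' : P.IsAdmissible w := Or.inr ⟨U, V, hw⟩
  by_cases hno : ∀ z, z ≡ P.toHom w z [ZMOD n]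
  · have hcross {r : W} (hr : IsFirstLetter cs w r) :
        ∃ a b, P.ActsAsSwap r a b ∧ a ∈ U ∧ b ∈ V := by
      rcases IsFirstLetter.orbitArc_or_mem hw hr with ⟨x, y, j, hxy, harc⟩ | h
      · obtain ⟨u, hu, -⟩ := hw'.connected_arrow hr hxy harc
        exact absurd (hno x) hu.2.1
      · exact h
    obtain ⟨a, b, h, ha, hb⟩ := hcross hr
    obtain ⟨a', b', h', ha', hb'⟩ := hcross ht
    exact hw.connected_of_no_arrow hno ha hb h ha' hb' h'
  · push Not at hno
    obtain ⟨z, hz⟩ := hno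
    obtain ⟨u, hu⟩ := P.exists_reflection_actsAsSwap hz
    obtain ⟨a₀, ha₀⟩ := hw.nonempty_left
    obtain ⟨b₀, hb₀⟩ := hw.nonempty_right
    obtain ⟨s, hs⟩ := P.exists_reflection_actsAsSwap (hw.not_modEq ha₀ hb₀)
    have hall {r : W} (hr : IsFirstLetter cs w r) :
        Relation.EqvGen (AreFirstLetters cs w) r u := by
      rcases IsFirstLetter.orbitArc_or_mem hw hr with ⟨x, y, j, hxy, harc⟩ | ⟨a, b, h, ha, hb⟩
      · obtain ⟨v, hv, h⟩ := hw'.connected_arrow hr hxy harc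
        exact h.trans _ _ _ (((hw.connected_arrow ha₀ hb₀ hs hv).symm _ _).trans _ _ _
          (hw.connected_arrow ha₀ hb₀ hs hu))
      · exact hw.connected_arrow ha hb h hu
    exact (hall hr).trans _ _ _ ((hall ht).symm _ _)

theorem IsAdmissible.connected {w r t : W} (hw : P.IsAdmissible w)
    (hr : IsFirstLetter cs w r) (ht : IsFirstLetter cs w t) :
    Relation.EqvGen (AreFirstLetters cs w) r t := by
  rcases hw with hw | ⟨U, V, hw⟩
  · exact hw.connected hr ht
  · exact hw.connected hr ht

end PeriodicModel

/-! ### Reduced words, the Hurwitz monoid and the dual monoid -/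

section Words

variable {B W : Type*} [Group W] {M : CoxeterMatrix B} (cs : CoxeterSystem M W)

theorem reflLength_conj_le (g w : W) : reflLength cs (g * w * g⁻¹) ≤ reflLength cs w := by
  obtain ⟨l, hl, rfl, hlen⟩ := exists_reduced_reflection_word cs w
  have h1 : g * l.prod * g⁻¹ = (l.map (MulAut.conj g)).prod := by
    rw [← MulAut.conj_apply, map_list_prod]
  rw [h1, ← hlen, ← List.length_map (MulAut.conj g)]
  refine reflLength_prod_le cs _ fun r hr => ?_
  obtain ⟨t, ht, rfl⟩ := List.mem_map.1 hr
  exact (hl t ht).conj g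

theorem reflLength_conj (g w : W) : reflLength cs (g * w * g⁻¹) = reflLength cs w := by
  refine le_antisymm (reflLength_conj_le cs g w) ?_
  have := reflLength_conj_le cs g⁻¹ (g * w * g⁻¹)
  rwa [show g⁻¹ * (g * w * g⁻¹) * g⁻¹⁻¹ = w by group] at this

variable {cs}

/-- A middle factor can be moved to the front by conjugating u, and conjugation preserves reflection
length. -/
theorem divides_of_factor {u w v c : W} (hc : c = u * w * v)
    (hlen : reflLength cs u + reflLength cs w + reflLength cs v ≤ reflLength cs c) :
    Divides cs w c := by
  refine ⟨w⁻¹ * u * w⁻¹⁻¹ * v, by rw [hc]; group, ?_⟩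
  have h1 := reflLength_mul_le cs (w⁻¹ * u * w⁻¹⁻¹) v
  rw [reflLength_conj] at h1
  have h2 := reflLength_mul_le cs w (w⁻¹ * u * w⁻¹⁻¹ * v)
  rw [show w * (w⁻¹ * u * w⁻¹⁻¹ * v) = c by rw [hc]; group] at h2
  omega

theorem Divides.trans {u w c : W} (h : Divides cs u w) (h' : Divides cs w c) :
    Divides cs u c := by
  obtain ⟨v, rfl, hv⟩ := h
  obtain ⟨v', rfl, hv'⟩ := h'
  exact divides_of_factor (u := 1) (v := v * v') (by group) (by
    have := reflLength_mul_le cs v v'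
    rw [reflLength_one]; omega)

theorem IsFirstLetter.reflLength_eq {w r : W} (h : IsFirstLetter cs w r) :
    reflLength cs w = reflLength cs (r * w) + 1 := by
  have h1 := reflLength_mul_le cs r (r * w)
  rw [← mul_assoc, h.1.mul_self, one_mul, reflLength_eq_one cs h.1] at h1
  have := h.2
  omega

theorem IsFirstLetter.divides {w r : W} (h : IsFirstLetter cs w r) : Divides cs r w :=
  ⟨r * w, by rw [← mul_assoc, h.1.mul_self, one_mul], by
    rw [reflLength_eq_one cs h.1, h.reflLength_eq, add_comm]⟩

theorem IsFirstLetter.divides_mul {w r : W} (h : IsFirstLetter cs w r) : Divides cs (r * w) w :=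
  divides_of_factor (u := r) (v := 1) (by rw [← mul_assoc, h.1.mul_self, one_mul, mul_one]) (by
    rw [reflLength_eq_one cs h.1, h.reflLength_eq, reflLength_one]; omega)

theorem AreFirstLetters.ne {w r t : W} (h : AreFirstLetters cs w r t) : r ≠ t := by
  rintro rfl
  have h1 := h.2.2
  rw [← mul_assoc, h.1.1.mul_self, one_mul] at h1
  exact lt_asymm h1 h.1.2

theorem AreFirstLetters.divides {w r t : W} (h : AreFirstLetters cs w r t) :
    Divides cs (r * t) w := by
  refine ⟨t * (r * w), ?_, ?_⟩
  · rw [mul_assoc, ← mul_assoc t t, h.2.1.mul_self, one_mul, ← mul_assoc, h.1.1.mul_self, one_mul]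
  · rw [reflLength_mul_eq_two cs h.1.1 h.2.1 h.ne, h.1.reflLength_eq, h.2.reflLength_eq]
    omega

/-- Because r t = t (trt), a factorization starting with r, t can be rewritten to start with t. -/
theorem AreFirstLetters.isFirstLetter_right {w r t : W} (h : AreFirstLetters cs w r t) :
    IsFirstLetter cs w t := by
  refine ⟨h.2.1, ?_⟩
  have h1 := reflLength_mul_le cs (t * r * t) (t * (r * w))
  rw [reflLength_eq_one cs (isReflection_conj cs h.2.1 h.1.1),
    show t * r * t * (t * (r * w)) = t * w by
      rw [← mul_assoc (t * r * t), mul_assoc (t * r), h.2.1.mul_self, mul_one, mul_assoc t r,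
        ← mul_assoc r r, h.1.1.mul_self, one_mul]] at h1
  have h2 := h.1.reflLength_eq
  have h3 := h.2.reflLength_eq
  omega

variable {c : W}

theorem exists_reflDivisor_word {w : W} (hw : Divides cs w c) :
    ∃ l : List (ReflDivisor cs c), (l.map Subtype.val).prod = w ∧ l.length = reflLength cs w := by
  induction hk : reflLength cs w generalizing w with
  | zero =>
    obtain ⟨l, -, hl, hlen⟩ := exists_reduced_reflection_word cs w
    rw [hk, List.length_eq_zero_iff] at hlen
    exact ⟨[], by simpa [hlen] using hl, rfl⟩
  | succ k ih =>
    obtain ⟨l, hl, hlw, hlen⟩ := exists_reduced_reflection_word cs w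
    obtain ⟨r, l, rfl⟩ := List.exists_cons_of_length_eq_add_one (hlen.trans hk)
    have hr := hl r (by simp)
    have hrw : r * w = l.prod := by
      rw [← hlw, List.prod_cons, ← mul_assoc, hr.mul_self, one_mul]
    have hfirst : IsFirstLetter cs w r := by
      refine ⟨hr, ?_⟩
      have := reflLength_prod_le cs l fun t ht => hl t (by simp [ht])
      rw [hrw, ← hlen, List.length_cons]
      omega
    have := hfirst.reflLength_eq
    obtain ⟨m, hm, hmlen⟩ := ih (hfirst.divides_mul.trans hw) (by omega)
    refine ⟨⟨r, hr, hfirst.divides.trans hw⟩ :: m, ?_, by simp [hmlen]⟩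
    rw [List.map_cons, List.prod_cons, hm, ← mul_assoc, hr.mul_self, one_mul]

theorem hurwitz_relation (r t u : ReflDivisor cs c) (hne : r.1 ≠ t.1)
    (h : Divides cs (r.1 * t.1) c) (hu : u.1 = r.1 * t.1 * r.1) :
    PresentedMonoid.of (HurwitzRel cs c) r * PresentedMonoid.of (HurwitzRel cs c) t =
      PresentedMonoid.of (HurwitzRel cs c) u * PresentedMonoid.of (HurwitzRel cs c) r := by
  obtain ⟨u, hu'⟩ := u
  obtain rfl : u = r.1 * t.1 * r.1 := hu
  exact PresentedMonoid.mk_eq_mk_of_rel (HurwitzRel.rel r.1 t.1 r.2.1 t.2.1 hne h)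

/-- The value in the Hurwitz monoid of a word in the reflections dividing `c`. -/
def hurwitzProd (l : List (ReflDivisor cs c)) : PresentedMonoid (HurwitzRel cs c) :=
  (l.map (PresentedMonoid.of (HurwitzRel cs c))).prod

theorem hurwitzProd_cons (r : ReflDivisor cs c) (l : List (ReflDivisor cs c)) :
    hurwitzProd (r :: l) = PresentedMonoid.of (HurwitzRel cs c) r * hurwitzProd l := by
  simp [hurwitzProd]

/-- The value in the Hurwitz monoid of a chosen reduced factorization of a divisor of `c`. -/
noncomputable def hurwitzElement (w : W) (hw : Divides cs w c) :
    PresentedMonoid (HurwitzRel cs c) :=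
  hurwitzProd (exists_reflDivisor_word hw).choose

open Classical in
/-- All reduced factorizations of a divisor of `c` have the same value in the Hurwitz monoid, as
soon as the first letters of each divisor are connected. -/
theorem hurwitzProd_eq
    (hconn : ∀ w, Divides cs w c → ∀ r t, IsFirstLetter cs w r → IsFirstLetter cs w t →
      Relation.EqvGen (AreFirstLetters cs w) r t)
    {w : W} (hw : Divides cs w c) {l : List (ReflDivisor cs c)}
    (hl : (l.map Subtype.val).prod = w) (hlen : l.length = reflLength cs w) :
    hurwitzProd l = hurwitzElement w hw := by
  induction hk : reflLength cs w generalizing w l with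
  | zero =>
    have h1 := (exists_reflDivisor_word hw).choose_spec.2.trans hk
    rw [hk, List.length_eq_zero_iff] at hlen
    rw [List.length_eq_zero_iff] at h1
    rw [hurwitzElement, h1, hlen]
  | succ k ih =>
    have hletter (r : W) (h : IsFirstLetter cs w r) : cs.IsReflection r ∧ Divides cs r c :=
      ⟨h.1, h.divides.trans hw⟩
    -- The value of the reduced words starting with r. The default 1 only makes `val` total, since
    -- `Relation.EqvGen` ranges over all of W.
    let val (r : W) : PresentedMonoid (HurwitzRel cs c) :=
      if h : IsFirstLetter cs w r then
        PresentedMonoid.of (HurwitzRel cs c) ⟨r, hletter r h⟩ *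
          hurwitzElement (r * w) (h.divides_mul.trans hw)
      else 1
    have hval (r : W) (h : IsFirstLetter cs w r) : val r =
        PresentedMonoid.of (HurwitzRel cs c) ⟨r, hletter r h⟩ *
          hurwitzElement (r * w) (h.divides_mul.trans hw) := dif_pos h
    -- Take a common tail m with w = r t m = t (trt) m. The relation for the pair t, trt reads t
    -- (trt) = r t, because t (trt) t = r.
    have hedge (r t : W) (h : AreFirstLetters cs w r t) : val r = val t := by
      have h1 := h.1.reflLength_eq
      have h2 := h.2.reflLength_eq
      have h3 := h.isFirstLetter_right
      have h4 := h3.reflLength_eq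
      obtain ⟨m, hm, hmlen⟩ :=
        exists_reflDivisor_word (h.2.divides_mul.trans (h.1.divides_mul.trans hw))
      have hne' : t ≠ t * r * t := by
        intro he
        apply h.ne
        have := mul_eq_one_iff_eq_inv.1 (mul_eq_right.1 he.symm)
        rw [h.1.1.inv] at this
        exact this.symm
      have htrt : t * (t * r * t) = r * t := by
        rw [← mul_assoc, ← mul_assoc, h.2.1.mul_self, one_mul]
      have hd : Divides cs (t * (t * r * t)) c := htrt ▸ h.divides.trans hw
      have hdc : cs.IsReflection (t * r * t) ∧ Divides cs (t * r * t) c :=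
        ⟨isReflection_conj cs h.2.1 h.1.1,
          divides_right cs h.2.1 (isReflection_conj cs h.2.1 h.1.1) hne' hd⟩
      rw [hval r h.1, hval t h3,
        ← ih (h.1.divides_mul.trans hw) (l := ⟨t, hletter t h3⟩ :: m) ?_ (by simp; omega)
          (by omega),
        ← ih (h3.divides_mul.trans hw) (l := ⟨t * r * t, hdc⟩ :: m) ?_ (by simp; omega)
          (by omega),
        hurwitzProd_cons, hurwitzProd_cons, ← mul_assoc, ← mul_assoc,
        hurwitz_relation ⟨t, hletter t h3⟩ ⟨t * r * t, hdc⟩ ⟨r, hletter r h.1⟩ hne' hd]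
      · rw [htrt, mul_assoc, h.2.1.mul_self, mul_one]
      · rw [List.map_cons, List.prod_cons, hm, ← mul_assoc (t * r * t), mul_assoc (t * r),
          h.2.1.mul_self, mul_one, mul_assoc t r, ← mul_assoc r r, h.1.1.mul_self, one_mul]
      · rw [List.map_cons, List.prod_cons, hm, ← mul_assoc, h.2.1.mul_self, one_mul]
    have heqv (r t : W) (h : Relation.EqvGen (AreFirstLetters cs w) r t) : val r = val t := by
      induction h with
      | rel r t h => exact hedge r t h
      | refl r => rfl
      | symm r t _ h => exact h.symm
      | trans r t u _ _ h h' => exact h.trans h'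
    have hword (l : List (ReflDivisor cs c)) (hl : (l.map Subtype.val).prod = w)
        (hlen : l.length = reflLength cs w) :
        ∃ r, IsFirstLetter cs w r ∧ hurwitzProd l = val r := by
      obtain ⟨r, l, rfl⟩ := List.exists_cons_of_length_eq_add_one (hlen.trans hk)
      rw [List.map_cons, List.prod_cons] at hl
      rw [List.length_cons] at hlen
      have hrw : (l.map Subtype.val).prod = r.1 * w := by
        rw [← hl, ← mul_assoc, r.2.1.mul_self, one_mul]
      have hfirst : IsFirstLetter cs w r.1 := by
        refine ⟨r.2.1, ?_⟩
        have := reflLength_prod_le cs (l.map Subtype.val) fun t ht => by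
          obtain ⟨t, -, rfl⟩ := List.mem_map.1 ht
          exact t.2.1
        rw [hrw, List.length_map] at this
        omega
      have := hfirst.reflLength_eq
      refine ⟨r.1, hfirst, ?_⟩
      rw [hval r.1 hfirst, hurwitzProd_cons,
        ih (hfirst.divides_mul.trans hw) hrw (by omega) (by omega)]
    obtain ⟨r, hr, h1⟩ := hword l hl hlen
    obtain ⟨t, ht, h2⟩ := hword _ (exists_reflDivisor_word hw).choose_spec.1
      (exists_reflDivisor_word hw).choose_spec.2
    rw [hurwitzElement, h1, h2]
    exact heqv r t (hconn w hw r t hr ht)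

theorem under_mul_under {w w' : W} (hw : Divides cs w c) (hw' : Divides cs w' c)
    (hww' : Divides cs (w * w') c)
    (hlen : reflLength cs (w * w') = reflLength cs w + reflLength cs w') :
    DualMonoid.under cs c w hw * DualMonoid.under cs c w' hw' =
      DualMonoid.under cs c (w * w') hww' :=
  PresentedMonoid.mk_eq_mk_of_rel (DualRel.mul w w' hw hw' hww' hlen)

theorem under_congr {w w' : W} (h : w = w') (hw : Divides cs w c) (hw' : Divides cs w' c) :
    DualMonoid.under cs c w hw = DualMonoid.under cs c w' hw' := by subst h; rfl

theorem under_one (h : Divides cs 1 c) : DualMonoid.under cs c 1 h = 1 :=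
  PresentedMonoid.mk_eq_mk_of_rel DualRel.one

theorem under_hurwitz {r t : W} (hr : cs.IsReflection r) (ht : cs.IsReflection t) (hne : r ≠ t)
    (h : Divides cs (r * t) c) :
    DualMonoid.under cs c r (divides_left cs hr ht hne h) *
        DualMonoid.under cs c t (divides_right cs hr ht hne h) =
      DualMonoid.under cs c (r * t * r) (divides_conj cs hr ht hne h) *
        DualMonoid.under cs c r (divides_left cs hr ht hne h) := by
  have e : r * t * r * r = r * t := by rw [mul_assoc (r * t), hr.mul_self, mul_one]
  have hlen := reflLength_mul_eq_two cs hr ht hne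
  rw [under_mul_under _ _ h, under_mul_under _ _ (by rw [e]; exact h)]
  · exact under_congr e.symm _ _
  · rw [e, hlen, reflLength_eq_one cs hr, reflLength_eq_one cs (isReflection_conj cs hr ht)]
  · rw [hlen, reflLength_eq_one cs hr, reflLength_eq_one cs ht]

variable (cs c) in
/-- The natural map from the Hurwitz monoid to the dual monoid. -/
def hurwitzToDual : PresentedMonoid (HurwitzRel cs c) →* DualMonoid cs c :=
  PresentedMonoid.lift (fun r => DualMonoid.under cs c r.1 r.2.2) (by
    rintro _ _ ⟨r, t, hr, ht, hne, h⟩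
    simpa using under_hurwitz hr ht hne h)

theorem hurwitzToDual_hurwitzProd {w : W} (hw : Divides cs w c) {l : List (ReflDivisor cs c)}
    (hl : (l.map Subtype.val).prod = w) (hlen : l.length = reflLength cs w) :
    hurwitzToDual cs c (hurwitzProd l) = DualMonoid.under cs c w hw := by
  induction l generalizing w with
  | nil =>
    obtain rfl : 1 = w := by simpa using hl
    rw [under_one]
    simp [hurwitzProd]
  | cons r l ih =>
    rw [List.map_cons, List.prod_cons] at hl
    rw [List.length_cons] at hlen
    have hrw : (l.map Subtype.val).prod = r.1 * w := by
      rw [← hl, ← mul_assoc, r.2.1.mul_self, one_mul]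
    have hfirst : IsFirstLetter cs w r.1 := by
      refine ⟨r.2.1, ?_⟩
      have := reflLength_prod_le cs (l.map Subtype.val) fun t ht => by
        obtain ⟨t, -, rfl⟩ := List.mem_map.1 ht
        exact t.2.1
      rw [hrw, List.length_map] at this
      omega
    have h1 := hfirst.reflLength_eq
    have e : r.1 * (r.1 * w) = w := by rw [← mul_assoc, r.2.1.mul_self, one_mul]
    rw [hurwitzProd_cons, map_mul, ih (hfirst.divides_mul.trans hw) hrw (by omega)]
    change DualMonoid.under cs c r.1 r.2.2 * _ = _
    rw [under_mul_under _ _ (e.symm ▸ hw)]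
    · exact under_congr e _ _
    · rw [e, reflLength_eq_one cs r.2.1, h1, add_comm]

/-- The inverse sends w to the value of a chosen reduced factorization. It respects the product
relations because concatenating the reduced words of w and w' gives a reduced word of w w', whose
value does not depend on choices. -/
theorem exists_hurwitz_mulEquiv_dual
    (hconn : ∀ w, Divides cs w c → ∀ r t, IsFirstLetter cs w r → IsFirstLetter cs w t →
      Relation.EqvGen (AreFirstLetters cs w) r t) :
    ∃ φ : PresentedMonoid (HurwitzRel cs c) ≃* DualMonoid cs c,
      ∀ r : ReflDivisor cs c, φ (PresentedMonoid.of (HurwitzRel cs c) r) =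
        DualMonoid.under cs c r.1 r.2.2 := by
  have hspec {w : W} (hw : Divides cs w c) := (exists_reflDivisor_word hw).choose_spec
  let back : DualMonoid cs c →* PresentedMonoid (HurwitzRel cs c) :=
    PresentedMonoid.lift (fun w => hurwitzElement w.1 w.2) (by
      rintro _ _ (_ | ⟨w, w', hw, hw', hww', hlen⟩)
      · rw [FreeMonoid.lift_eval_of, map_one,
          ← hurwitzProd_eq hconn _ (l := []) (by simp) (by simp [reflLength_one])]
        simp [hurwitzProd]
      · rw [map_mul, FreeMonoid.lift_eval_of, FreeMonoid.lift_eval_of, FreeMonoid.lift_eval_of,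
          ← hurwitzProd_eq hconn hww'
            (l := (exists_reflDivisor_word hw).choose ++ (exists_reflDivisor_word hw').choose)
            (by rw [List.map_append, List.prod_append, (hspec hw).1, (hspec hw').1])
            (by rw [List.length_append, (hspec hw).2, (hspec hw').2, hlen])]
        simp [hurwitzProd, hurwitzElement])
  have hback (w : Divisor cs c) :
      back (PresentedMonoid.of (DualRel cs c) w) = hurwitzElement w.1 w.2 := rfl
  have hforth (r : ReflDivisor cs c) :
      hurwitzToDual cs c (PresentedMonoid.of (HurwitzRel cs c) r) =
        DualMonoid.under cs c r.1 r.2.2 := rfl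
  refine ⟨MonoidHom.toMulEquiv (hurwitzToDual cs c) back ?_ ?_, hforth⟩
  · refine PresentedMonoid.ext _ fun r => ?_
    rw [MonoidHom.comp_apply, hforth, DualMonoid.under, hback, MonoidHom.id_apply,
      ← hurwitzProd_eq hconn r.2.2 (l := [r]) (by simp) (by simp [reflLength_eq_one cs r.2.1])]
    simp [hurwitzProd]
  · refine PresentedMonoid.ext _ fun w => ?_
    rw [MonoidHom.comp_apply, hback, MonoidHom.id_apply]
    exact hurwitzToDual_hurwitzProd w.2 (hspec w.2).1 (hspec w.2).2

/-- Formal: a monoid presentation read in groups presents the enveloping group of the monoid, and φ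
identifies the two monoids. -/
theorem exists_hurwitz_mulEquiv_fractions
    (φ : PresentedMonoid (HurwitzRel cs c) ≃* DualMonoid cs c)
    (hφ : ∀ r : ReflDivisor cs c, φ (PresentedMonoid.of (HurwitzRel cs c) r) =
        DualMonoid.under cs c r.1 r.2.2) :
    ∃ ψ : PresentedGroup (hurwitzRelators cs c) ≃* GroupOfFractions (DualMonoid cs c),
      ∀ r : ReflDivisor cs c, ψ (PresentedGroup.of r) =
        GroupOfFractions.ofMonoid (DualMonoid cs c) (DualMonoid.under cs c r.1 r.2.2) := by
  let N := DualMonoid cs c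
  have hmul (a b : N) : GroupOfFractions.ofMonoid N (a * b) =
      GroupOfFractions.ofMonoid N a * GroupOfFractions.ofMonoid N b :=
    (PresentedGroup.mk_eq_mk_of_mul_inv_mem (rels := {x : FreeGroup N | ∃ a b : N,
      x = FreeGroup.of a * FreeGroup.of b * (FreeGroup.of (a * b))⁻¹}) ⟨a, b, rfl⟩).symm
  let ι : N →* GroupOfFractions N := MonoidHom.mk' (GroupOfFractions.ofMonoid N) hmul
  have hrel (a b : FreeMonoid (ReflDivisor cs c)) (h : HurwitzRel cs c a b) :
      FreeMonoid.lift (PresentedGroup.of (rels := hurwitzRelators cs c)) a =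
        FreeMonoid.lift PresentedGroup.of b := by
    have h1 : PresentedGroup.mk (hurwitzRelators cs c) (FreeMonoid.lift FreeGroup.of a) =
        PresentedGroup.mk (hurwitzRelators cs c) (FreeMonoid.lift FreeGroup.of b) :=
      PresentedGroup.mk_eq_mk_of_mul_inv_mem ⟨a, b, h, rfl⟩
    rwa [FreeMonoid.hom_map_lift, FreeMonoid.hom_map_lift] at h1
  let θ : PresentedMonoid (HurwitzRel cs c) →* PresentedGroup (hurwitzRelators cs c) :=
    PresentedMonoid.lift PresentedGroup.of hrel
  let forth : PresentedGroup (hurwitzRelators cs c) →* GroupOfFractions N :=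
    PresentedGroup.toGroup (f := fun r => ι (DualMonoid.under cs c r.1 r.2.2)) (by
      rintro _ ⟨_, _, ⟨r, t, hr, ht, hne, h⟩, rfl⟩
      have := congrArg ι (under_hurwitz hr ht hne h)
      rw [map_mul, map_mul] at this
      simp [this])
  let back : GroupOfFractions N →* PresentedGroup (hurwitzRelators cs c) :=
    PresentedGroup.toGroup (f := fun a => θ (φ.symm a)) (by
      rintro _ ⟨a, b, rfl⟩
      simp)
  have hforth (r : ReflDivisor cs c) :
      forth (PresentedGroup.of r) = ι (DualMonoid.under cs c r.1 r.2.2) :=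
    PresentedGroup.toGroup.of _
  have hback (a : N) : back (PresentedGroup.of a) = θ (φ.symm a) := PresentedGroup.toGroup.of _
  have hcomp : (forth.comp θ) = ι.comp φ.toMonoidHom := by
    refine PresentedMonoid.ext _ fun r => ?_
    change forth (PresentedGroup.of r) = ι (φ (PresentedMonoid.of _ r))
    rw [hforth, hφ]
  refine ⟨MonoidHom.toMulEquiv forth back ?_ ?_, hforth⟩
  · refine PresentedGroup.ext fun r => ?_
    rw [MonoidHom.comp_apply, hforth, MonoidHom.id_apply]
    change back (PresentedGroup.of _) = _
    rw [hback, ← hφ, MulEquiv.symm_apply_apply]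
    rfl
  · refine PresentedGroup.ext fun a => ?_
    rw [MonoidHom.comp_apply, hback, MonoidHom.id_apply]
    refine (DFunLike.congr_fun hcomp (φ.symm a)).trans ?_
    change ι (φ (φ.symm a)) = _
    rw [MulEquiv.apply_symm_apply]
    rfl

end Words

/-! ### Admissibility of all divisors -/

namespace PeriodicModel

variable {B W : Type*} [Group W] {M : CoxeterMatrix B} {cs : CoxeterSystem M W} {n : ℕ}
  {P : PeriodicModel cs n}

/-- Write c = w v = (w v w⁻¹) w. Reduced letters of the conjugate can be removed from the left one
at a time, each being a first letter of what remains, until w is left. -/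
theorem IsAdmissible.of_divides {w c : W} (hc : P.IsAdmissible c) (hw : Divides cs w c) :
    P.IsAdmissible w := by
  obtain ⟨v, rfl, hlen⟩ := hw
  obtain ⟨l, hl, hlv, hll⟩ := exists_reduced_reflection_word cs (w * v * w⁻¹)
  rw [reflLength_conj] at hll
  rw [show w * v = l.prod * w by rw [hlv]; group] at hc hlen
  rw [← hll] at hlen
  clear hlv hll
  induction l with
  | nil => simpa using hc
  | cons r l ih =>
    rw [List.prod_cons, mul_assoc, List.length_cons] at hlen
    rw [List.prod_cons, mul_assoc] at hc
    have hr := hl r (by simp)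
    have e : r * (r * (l.prod * w)) = l.prod * w := by rw [← mul_assoc, hr.mul_self, one_mul]
    have hl' : ∀ t ∈ l, cs.IsReflection t := fun t ht => hl t (by simp [ht])
    have h1 := reflLength_mul_le cs l.prod w
    have h2 := reflLength_prod_le cs l hl'
    have h3 := reflLength_le_mul_add_one hr (r * (l.prod * w))
    rw [e] at h3
    have hfirst : IsFirstLetter cs (r * (l.prod * w)) r := ⟨hr, by rw [e]; omega⟩
    have hc' := hc.mul_of_isFirstLetter hfirst
    rw [e] at hc'
    apply ih <;> first | assumption | omega

end PeriodicModel

/-! ### The affine Coxeter group as affine permutations -/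

section AffineSymmetric

variable {n : ℕ}

theorem not_modEq_add {k : ℤ} (h0 : 0 < k) (hk : k < n) (x : ℤ) : ¬ x ≡ x + k [ZMOD n] := by
  intro h
  rw [Int.modEq_iff_dvd, add_sub_cancel_left] at h
  exact absurd (Int.le_of_dvd h0 h) (by omega)

variable (n) in
/-- The affine simple transposition exchanging `x` and `x + 1`, and all their translates. -/
def adjacentSwap (hn : 2 ≤ n) (x : ℤ) : Equiv.Perm ℤ :=
  (periodicSwap_involutive (not_modEq_add one_pos (by exact_mod_cast hn) x)).toPerm

theorem not_modEq_succ (hn : 2 ≤ n) (x : ℤ) : ¬ x ≡ x + 1 [ZMOD n] :=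
  not_modEq_add one_pos (by exact_mod_cast hn) x

theorem adjacentSwap_apply (hn : 2 ≤ n) (x z : ℤ) :
    adjacentSwap n hn x z = periodicSwap n x (x + 1) z := rfl

theorem adjacentSwap_add (hn : 2 ≤ n) (x z : ℤ) :
    adjacentSwap n hn x (z + n) = adjacentSwap n hn x z + n := by
  have := periodicSwap_add (not_modEq_succ hn x) z 1
  rwa [one_mul] at this

theorem adjacentSwap_eq_of_modEq (hn : 2 ≤ n) {x y : ℤ} (h : x ≡ y [ZMOD n]) :
    adjacentSwap n hn x = adjacentSwap n hn y := by
  obtain ⟨k, rfl⟩ := modEq_iff_exists_add.1 h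
  ext z
  rw [adjacentSwap_apply, adjacentSwap_apply, show y + k * n + 1 = y + 1 + k * n by ring,
    periodicSwap_shift]

theorem adjacentSwap_self (hn : 2 ≤ n) (x : ℤ) : adjacentSwap n hn x x = x + 1 := by
  rw [adjacentSwap_apply, periodicSwap_left_self]

theorem adjacentSwap_succ (hn : 2 ≤ n) (x : ℤ) : adjacentSwap n hn x (x + 1) = x := by
  rw [adjacentSwap_apply, periodicSwap_right_self (not_modEq_succ hn x)]

theorem adjacentSwap_of_ne (hn : 2 ≤ n) {x z : ℤ} (h : ¬ z ≡ x [ZMOD n])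
    (h' : ¬ z ≡ x + 1 [ZMOD n]) : adjacentSwap n hn x z = z := by
  rw [adjacentSwap_apply, periodicSwap_of_ne h h']

theorem adjacentSwap_mul_self (hn : 2 ≤ n) (x : ℤ) :
    adjacentSwap n hn x * adjacentSwap n hn x = 1 := by
  ext z
  exact periodicSwap_involutive (not_modEq_succ hn x) z

theorem adjacentSwap_conj (hn : 2 ≤ n) (u : ℤ) {x y : ℤ} (hxy : ¬ x ≡ y [ZMOD n]) (z : ℤ) :
    adjacentSwap n hn u (periodicSwap n x y (adjacentSwap n hn u z)) =
      periodicSwap n (adjacentSwap n hn u x) (adjacentSwap n hn u y) z := by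
  rw [map_periodicSwap (adjacentSwap_add hn u) hxy]
  congr 1
  exact periodicSwap_involutive (not_modEq_succ hn u) z

theorem adjacentSwap_add_two (hn : 2 ≤ n) (h3 : 3 ≤ n) (x : ℤ) :
    adjacentSwap n hn x (x + 2) = x + 2 := by
  refine adjacentSwap_of_ne hn (not_modEq_symm (not_modEq_add two_pos (by omega) x)) ?_
  rw [show x + 2 = x + 1 + 1 by ring]
  exact not_modEq_symm (not_modEq_succ hn _)

theorem adjacentSwap_succ_self (hn : 2 ≤ n) (h3 : 3 ≤ n) (x : ℤ) :
    adjacentSwap n hn (x + 1) x = x := by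
  refine adjacentSwap_of_ne hn (not_modEq_succ hn x) ?_
  rw [show x + 1 + 1 = x + 2 by ring]
  exact not_modEq_add two_pos (by omega) x

/-- Both sides are the periodic transposition of x and x + 2. -/
theorem adjacentSwap_braid (hn : 2 ≤ n) (h3 : 3 ≤ n) (x : ℤ) :
    adjacentSwap n hn x * adjacentSwap n hn (x + 1) * adjacentSwap n hn x =
      adjacentSwap n hn (x + 1) * adjacentSwap n hn x * adjacentSwap n hn (x + 1) := by
  ext z
  have h1 := adjacentSwap_conj hn x (not_modEq_succ hn (x + 1)) z
  have h2 := adjacentSwap_conj hn (x + 1) (not_modEq_succ hn x) z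
  rw [adjacentSwap_succ, show x + 1 + 1 = x + 2 by ring, adjacentSwap_add_two hn h3] at h1
  rw [adjacentSwap_succ_self hn h3, adjacentSwap_self, show x + 1 + 1 = x + 2 by ring] at h2
  simp only [Equiv.Perm.mul_apply]
  rw [adjacentSwap_apply hn x ((adjacentSwap n hn (x + 1)) z), h2, ← h1,
    adjacentSwap_apply hn (x + 1), show x + 1 + 1 = x + 2 by ring]

theorem adjacentSwap_comm (hn : 2 ≤ n) {x y : ℤ} (h : ¬ x ≡ y [ZMOD n])
    (h1 : ¬ x + 1 ≡ y [ZMOD n]) (h2 : ¬ y + 1 ≡ x [ZMOD n]) :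
    adjacentSwap n hn x * adjacentSwap n hn y = adjacentSwap n hn y * adjacentSwap n hn x := by
  ext z
  have h3 := adjacentSwap_conj hn x (not_modEq_succ hn y) (adjacentSwap n hn x z)
  rw [adjacentSwap_of_ne hn (not_modEq_symm h) (not_modEq_symm h1), adjacentSwap_of_ne hn h2
    fun hc => h (Int.ModEq.add_right_cancel' 1 hc).symm] at h3
  rw [Equiv.Perm.mul_apply, Equiv.Perm.mul_apply, adjacentSwap_apply hn y z,
    adjacentSwap_apply hn y, ← h3, ← Equiv.Perm.mul_apply (adjacentSwap n hn x)
      (adjacentSwap n hn x), adjacentSwap_mul_self]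
  rfl

theorem affineA_apply (i j : Fin n) : (affineA n) i j = if i = j then 1
    else if n = 2 then 0
    else if ((i : ℕ) + 1) % n = (j : ℕ) ∨ ((j : ℕ) + 1) % n = (i : ℕ) then 3
    else 2 := rfl

theorem succ_mod_eq_iff (i j : Fin n) :
    ((i : ℕ) + 1) % n = (j : ℕ) ↔ (i : ℤ) + 1 ≡ j [ZMOD n] := by
  rw [show ((i : ℕ) : ℤ) + 1 = ((i + 1 : ℕ) : ℤ) by push_cast; rfl, Int.natCast_modEq_iff,
    Nat.ModEq, Nat.mod_eq_of_lt j.2]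

theorem eq_iff_modEq (i j : Fin n) : i = j ↔ (i : ℤ) ≡ j [ZMOD n] := by
  rw [Int.natCast_modEq_iff, Nat.ModEq, Nat.mod_eq_of_lt i.2, Nat.mod_eq_of_lt j.2, Fin.ext_iff]

theorem mul_pow_three_of_braid {G : Type*} [Group G] {a b : G} (ha : a * a = 1) (hb : b * b = 1)
    (h : a * b * a = b * a * b) : (a * b) ^ 3 = 1 := by
  calc (a * b) ^ 3 = (a * b * a) * (b * a * b) := by simp only [pow_succ, pow_zero, one_mul,
        mul_assoc]
    _ = a * b * (a * a) * b * a := by rw [← h]; simp only [mul_assoc]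
    _ = a * (b * b) * a := by rw [ha, mul_one]; simp only [mul_assoc]
    _ = 1 := by rw [hb, mul_one, ha]

theorem isLiftable_adjacentSwap (hn : 2 ≤ n) :
    (affineA n).IsLiftable fun i : Fin n => adjacentSwap n hn (i : ℤ) := by
  intro i j
  rw [affineA_apply]
  beta_reduce
  have hsq := adjacentSwap_mul_self hn
  split_ifs with h1 h2 h3
  · rw [h1, pow_one, hsq]
  · rw [pow_zero]
  · have h3' : 3 ≤ n := by omega
    rcases h3 with h | h
    · rw [succ_mod_eq_iff] at h
      rw [← adjacentSwap_eq_of_modEq hn h]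
      exact mul_pow_three_of_braid (hsq _) (hsq _) (adjacentSwap_braid hn h3' _)
    · rw [succ_mod_eq_iff] at h
      rw [← adjacentSwap_eq_of_modEq hn h]
      exact mul_pow_three_of_braid (hsq _) (hsq _) (adjacentSwap_braid hn h3' _).symm
  · push Not at h3
    rw [Ne, Ne, succ_mod_eq_iff, succ_mod_eq_iff] at h3
    rw [eq_iff_modEq] at h1
    have hc := adjacentSwap_comm hn h1 h3.1 h3.2
    rw [pow_two, mul_assoc, ← mul_assoc _ _ (adjacentSwap n hn j), ← hc,
      mul_assoc (adjacentSwap n hn i), hsq, mul_one, hsq]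

variable {W : Type*} [Group W] (cs : CoxeterSystem (affineA n) W)

/-- The action of the affine Coxeter group by affine permutations. -/
def affineHom (hn : 2 ≤ n) : W →* Equiv.Perm ℤ := cs.lift ⟨_, isLiftable_adjacentSwap hn⟩

theorem affineHom_simple (hn : 2 ≤ n) (i : Fin n) :
    affineHom cs hn (cs.simple i) = adjacentSwap n hn (i : ℤ) :=
  cs.lift_apply_simple (isLiftable_adjacentSwap hn) i

theorem affineHom_add (hn : 2 ≤ n) (w : W) (z : ℤ) :
    affineHom cs hn w (z + n) = affineHom cs hn w z + n := by
  induction w using cs.simple_induction_left generalizing z with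
  | one => simp
  | mul_simple_left w i ih =>
    rw [map_mul, Equiv.Perm.mul_apply, Equiv.Perm.mul_apply, ih, affineHom_simple,
      adjacentSwap_add]

/-- The residue of an integer, as an index of a simple reflection. -/
def residue (hn : 2 ≤ n) (x : ℤ) : Fin n :=
  ⟨(x % n).toNat, by
    have h0 := Int.emod_nonneg x (show (n : ℤ) ≠ 0 by omega)
    have h1 := Int.emod_lt_of_pos x (show (0 : ℤ) < n by omega)
    omega⟩

theorem residue_modEq (hn : 2 ≤ n) (x : ℤ) : ((residue hn x : ℕ) : ℤ) ≡ x [ZMOD n] := by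
  have h0 := Int.emod_nonneg x (show (n : ℤ) ≠ 0 by omega)
  rw [residue, Int.toNat_of_nonneg h0]
  exact Int.mod_modEq x n

theorem residue_eq_iff (hn : 2 ≤ n) {x y : ℤ} :
    residue hn x = residue hn y ↔ x ≡ y [ZMOD n] := by
  rw [eq_iff_modEq]
  exact ⟨fun h => (residue_modEq hn x).symm.trans (h.trans (residue_modEq hn y)),
    fun h => (residue_modEq hn x).trans (h.trans (residue_modEq hn y).symm)⟩

theorem residue_natCast (hn : 2 ≤ n) (i : Fin n) : residue hn ((i : ℕ) : ℤ) = i := by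
  rw [eq_iff_modEq]
  exact residue_modEq hn _

theorem affineHom_simple_residue (hn : 2 ≤ n) (x : ℤ) :
    affineHom cs hn (cs.simple (residue hn x)) = adjacentSwap n hn x := by
  rw [affineHom_simple]
  exact adjacentSwap_eq_of_modEq hn (residue_modEq hn x)

theorem affineA_residue_succ (hn : 2 ≤ n) (h3 : 3 ≤ n) (x : ℤ) :
    (affineA n) (residue hn x) (residue hn (x + 1)) = 3 := by
  rw [affineA_apply, if_neg, if_neg (by omega), if_pos]
  · left
    rw [succ_mod_eq_iff]
    exact ((residue_modEq hn x).add_right 1).trans (residue_modEq hn _).symm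
  · rw [residue_eq_iff]
    exact not_modEq_succ hn x

theorem affineA_residue_of_ne (hn : 2 ≤ n) {x y : ℤ} (h : ¬ x ≡ y [ZMOD n])
    (h1 : ¬ x + 1 ≡ y [ZMOD n]) (h2 : ¬ y + 1 ≡ x [ZMOD n]) :
    n = 2 ∨ (affineA n) (residue hn x) (residue hn y) = 2 := by
  by_cases hn2 : n = 2
  · exact Or.inl hn2
  right
  rw [affineA_apply, if_neg, if_neg hn2, if_neg]
  · rw [succ_mod_eq_iff, succ_mod_eq_iff]
    rintro (hc | hc)
    · exact h1 ((((residue_modEq hn x).add_right 1).symm.trans hc).trans (residue_modEq hn y))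
    · exact h2 ((((residue_modEq hn y).add_right 1).symm.trans hc).trans (residue_modEq hn x))
  · rw [residue_eq_iff]
    exact h

theorem simple_braid {B : Type*} {M : CoxeterMatrix B} (cs : CoxeterSystem M W) {i j : B}
    (h : M i j = 3) :
    cs.simple i * cs.simple j * cs.simple i = cs.simple j * cs.simple i * cs.simple j := by
  have h1 := cs.simple_mul_simple_pow i j
  rw [h] at h1
  have h2 : (cs.simple i * cs.simple j * cs.simple i) *
      (cs.simple j * cs.simple i * cs.simple j) = 1 := by
    rw [← h1]; simp only [pow_succ, pow_zero, one_mul, mul_assoc]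
  have h3 := eq_inv_of_mul_eq_one_left h2
  rw [h3]
  simp [mul_assoc]

theorem simple_comm {B : Type*} {M : CoxeterMatrix B} (cs : CoxeterSystem M W) {i j : B}
    (h : M i j = 2) : cs.simple i * cs.simple j = cs.simple j * cs.simple i := by
  have h1 := cs.simple_mul_simple_pow i j
  rw [h, pow_two] at h1
  have h3 := eq_inv_of_mul_eq_one_left h1
  rw [h3]
  simp

theorem length_lt_of_comm {B : Type*} {M : CoxeterMatrix B} (cs : CoxeterSystem M W) {i j : B}
    (h : M i j = 2) {w : W} (hi : cs.length w < cs.length (w * cs.simple i))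
    (hj : cs.length (w * cs.simple j) < cs.length w) :
    cs.length (w * cs.simple j) < cs.length (w * cs.simple j * cs.simple i) := by
  have h1 := cs.length_mul_simple w i
  have h2 := cs.length_mul_simple w j
  have h3 := cs.length_mul_simple (w * cs.simple i) j
  rw [mul_assoc, simple_comm cs h, ← mul_assoc] at h3
  omega

/-- Otherwise w s_j s_i s_j = w s_i s_j s_i would have length l(w) - 3, though w s_i has length l(w)
+ 1 and two more letters lose at most 2. -/
theorem length_lt_of_braid {B : Type*} {M : CoxeterMatrix B} (cs : CoxeterSystem M W) {i j : B}
    (h : M i j = 3) {w : W} (hi : cs.length w < cs.length (w * cs.simple i))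
    (hj : cs.length (w * cs.simple j) < cs.length w)
    (hji : cs.length (w * cs.simple j * cs.simple i) < cs.length (w * cs.simple j)) :
    cs.length (w * cs.simple j * cs.simple i) <
      cs.length (w * cs.simple j * cs.simple i * cs.simple j) := by
  have h1 := cs.length_mul_simple w i
  have h2 := cs.length_mul_simple w j
  have h3 := cs.length_mul_simple (w * cs.simple i) j
  have h4 := cs.length_mul_simple (w * cs.simple i * cs.simple j) i
  have h5 := cs.length_mul_simple (w * cs.simple j) i
  have h6 : w * cs.simple i * cs.simple j * cs.simple i =
      w * cs.simple j * cs.simple i * cs.simple j := by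
    have := simple_braid cs h
    simp only [mul_assoc] at this ⊢
    rw [this]
  rw [h6] at h4
  omega

/-- A non-descent of `w` is an ascent of the corresponding affine permutation. -/
theorem affineHom_lt (hn : 2 ≤ n) (w : W) (x : ℤ)
    (hx : cs.length w < cs.length (w * cs.simple (residue hn x))) :
    affineHom cs hn w x < affineHom cs hn w (x + 1) := by
  induction hk : cs.length w using Nat.strong_induction_on generalizing w x with
  | _ k ih =>
    subst hk
    by_cases hw : w = 1
    · subst hw
      simp
    obtain ⟨j, hj⟩ := cs.exists_rightDescent_of_ne_one hw
    rw [CoxeterSystem.IsRightDescent] at hj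
    have hback (v : W) (j : Fin n) : v * cs.simple j * cs.simple j = v :=
      cs.simple_mul_simple_cancel_right j
    have happ (v : W) (y z : ℤ) : affineHom cs hn (v * cs.simple (residue hn y)) z =
        affineHom cs hn v (adjacentSwap n hn y z) := by
      rw [map_mul, Equiv.Perm.mul_apply, affineHom_simple_residue]
    have hxj : residue hn x ≠ j := by
      rintro rfl
      exact lt_asymm hx hj
    obtain ⟨y, rfl⟩ : ∃ y, residue hn y = j := ⟨_, residue_natCast hn j⟩
    rw [Ne, residue_eq_iff] at hxj
    set v := w * cs.simple (residue hn y) with hv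
    have hwv : w = v * cs.simple (residue hn y) := (hback w _).symm
    clear_value v
    have hvy : affineHom cs hn v y < affineHom cs hn v (y + 1) :=
      ih _ hj v y (by rw [← hwv]; exact hj) rfl
    -- With a descent y of w removed, the cases are y next above x, next below x, or not adjacent to
    -- x. In the adjacent cases for n ≥ 3, a further descent of v at x is removed too, and the braid
    -- relation supplies the ascent needed for the remaining element u.
    by_cases h1 : x + 1 ≡ y [ZMOD n]
    · rw [← (residue_eq_iff hn).2 h1] at hv hwv
      have hvy : affineHom cs hn v (x + 1) < affineHom cs hn v (x + 2) := by
        have := ih _ hj v (x + 1) (by rw [← hwv]; exact hj) rfl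
        rwa [show x + 1 + 1 = x + 2 by ring] at this
      have e1 : adjacentSwap n hn (x + 1) (x + 1) = x + 2 := by rw [adjacentSwap_self]; ring
      by_cases h3 : 3 ≤ n
      · have e2 := adjacentSwap_succ_self hn h3 x
        by_cases hvx : cs.length v < cs.length (v * cs.simple (residue hn x))
        · have := ih _ hj v x hvx rfl
          rw [hwv, happ, happ, e1, e2]
          omega
        · have hvx' : cs.length (v * cs.simple (residue hn x)) < cs.length v := by
            have := cs.length_mul_simple v (residue hn x)
            omega
          set u := v * cs.simple (residue hn x) with hu
          have hvu : v = u * cs.simple (residue hn x) := (hback v _).symm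
          clear_value u
          have hlt := length_lt_of_braid cs (affineA_residue_succ hn h3 x) hx (hv ▸ hj)
            (by rw [← hv, ← hu]; exact hvx')
          rw [← hv, ← hu] at hlt
          have h5 := ih _ (hvx'.trans hj) u x (by rw [← hvu]; exact hvx') rfl
          have h6 := ih _ (hvx'.trans hj) u (x + 1) hlt rfl
          rw [show x + 1 + 1 = x + 2 by ring] at h6
          rw [hwv, happ, happ, e1, e2, hvu, happ, happ, adjacentSwap_self,
            adjacentSwap_add_two hn h3]
          exact h6
      -- No braid relation is needed here: w x = v (x - 1) = v (x + 1) - 2, while w (x + 1) = v (x +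
      -- 2).
      · obtain rfl : n = 2 := by omega
        have e2 : adjacentSwap 2 hn (x + 1) x = x - 1 := by
          have h4 := adjacentSwap_succ hn (x + 1)
          have h5 := adjacentSwap_add hn (x + 1) x
          rw [show x + 1 + 1 = x + (2 : ℕ) by push_cast; ring, h5] at h4
          push_cast at h4
          linarith
        have h6 := affineHom_add cs hn v (x - 1)
        rw [show x - 1 + (2 : ℕ) = x + 1 by push_cast; ring] at h6
        push_cast at h6
        rw [hwv, happ, happ, e1, e2]
        omega
    by_cases h2 : y + 1 ≡ x [ZMOD n]
    · by_cases h3 : 3 ≤ n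
      · have hy : x - 1 ≡ y [ZMOD n] := by simpa using (h2.sub_right 1).symm
        rw [← (residue_eq_iff hn).2 hy] at hv hwv
        have hvy : affineHom cs hn v (x - 1) < affineHom cs hn v x := by
          have := ih _ hj v (x - 1) (by rw [← hwv]; exact hj) rfl
          rwa [sub_add_cancel] at this
        have e1 : adjacentSwap n hn (x - 1) x = x - 1 := by
          have := adjacentSwap_succ hn (x - 1)
          rwa [sub_add_cancel] at this
        have e2 : adjacentSwap n hn (x - 1) (x + 1) = x + 1 := by
          have := adjacentSwap_add_two hn h3 (x - 1)
          rwa [show x - 1 + 2 = x + 1 by ring] at this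
        have e3 : adjacentSwap n hn x (x - 1) = x - 1 := by
          have := adjacentSwap_succ_self hn h3 (x - 1)
          rwa [sub_add_cancel] at this
        have hM : (affineA n) (residue hn x) (residue hn (x - 1)) = 3 := by
          have := affineA_residue_succ hn h3 (x - 1)
          rwa [sub_add_cancel, (affineA n).symmetric] at this
        by_cases hvx : cs.length v < cs.length (v * cs.simple (residue hn x))
        · have := ih _ hj v x hvx rfl
          rw [hwv, happ, happ, e1, e2]
          omega
        · have hvx' : cs.length (v * cs.simple (residue hn x)) < cs.length v := by
            have := cs.length_mul_simple v (residue hn x)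
            omega
          set u := v * cs.simple (residue hn x) with hu
          have hvu : v = u * cs.simple (residue hn x) := (hback v _).symm
          clear_value u
          have hlt := length_lt_of_braid cs hM hx (hv ▸ hj) (by rw [← hv, ← hu]; exact hvx')
          rw [← hv, ← hu] at hlt
          have h6 := ih _ (hvx'.trans hj) u (x - 1) hlt rfl
          rw [sub_add_cancel] at h6
          rw [hwv, happ, happ, e1, e2, hvu, happ, happ, adjacentSwap_succ, e3]
          exact h6
      · obtain rfl : n = 2 := by omega
        exact absurd (((h2.symm.add_right 1).trans (by simp [Int.ModEq, add_assoc]))) h1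
    · rcases affineA_residue_of_ne hn hxj h1 h2 with rfl | hM
      · exfalso
        simp only [Int.ModEq, Nat.cast_ofNat] at hxj h1
        omega
      · have hlt := length_lt_of_comm cs hM hx (hv ▸ hj)
        rw [← hv] at hlt
        have h5 := ih _ hj v x hlt rfl
        rw [hwv, happ, happ, adjacentSwap_of_ne hn hxj (not_modEq_symm h2),
          adjacentSwap_of_ne hn h1 fun hc => hxj (Int.ModEq.add_right_cancel' 1 hc)]
        exact h5

/-- If w ≠ 1 acts trivially and i is a descent of w, then w s_i acts as s_i but has an ascent at i,
which is absurd. -/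
theorem affineHom_injective (hn : 2 ≤ n) : Function.Injective (affineHom cs hn) := by
  rw [injective_iff_map_eq_one]
  intro w hw
  by_contra hne
  obtain ⟨i, hi⟩ := cs.exists_rightDescent_of_ne_one hne
  rw [CoxeterSystem.IsRightDescent] at hi
  have h := affineHom_lt cs hn (w * cs.simple i) i (by
    rw [residue_natCast, cs.simple_mul_simple_cancel_right]; exact hi)
  rw [map_mul, hw, one_mul, affineHom_simple, adjacentSwap_self, adjacentSwap_succ] at h
  omega

/-- Conjugating by the simple swap at x turns (x + 1, y) into (x, y) and shortens the distance to be
treated. -/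
theorem exists_reflection_of_lt (hn : 2 ≤ n) (d : ℕ) (x : ℤ)
    (hne : ¬ x ≡ x + 1 + d [ZMOD n]) : ∃ r, cs.IsReflection r ∧
      ∀ z, affineHom cs hn r z = periodicSwap n x (x + 1 + d) z := by
  induction d using Nat.strong_induction_on generalizing x with
  | _ d ih =>
    rcases Nat.eq_zero_or_pos d with rfl | hd
    · refine ⟨cs.simple (residue hn x), cs.isReflection_simple _, fun z => ?_⟩
      rw [affineHom_simple_residue, adjacentSwap_apply]
      simp
    have hconj {r : W} {a b : ℤ} (hr : cs.IsReflection r) (hab : ¬ a ≡ b [ZMOD n])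
        (h : ∀ z, affineHom cs hn r z = periodicSwap n a b z) :
        ∃ t, cs.IsReflection t ∧ ∀ z, affineHom cs hn t z =
          periodicSwap n (adjacentSwap n hn x a) (adjacentSwap n hn x b) z :=
      ⟨cs.simple (residue hn x) * r * cs.simple (residue hn x),
        isReflection_conj cs (cs.isReflection_simple _) hr, fun z => by
          rw [map_mul, map_mul, Equiv.Perm.mul_apply, Equiv.Perm.mul_apply,
            affineHom_simple_residue, h, adjacentSwap_conj hn x hab]⟩
    -- When y = x + 1 + k n, the conjugation moves y as well; the shorter swap is then (x + 1, x + k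
    -- n), which brings both ends closer, hence d - 2.
    by_cases h : x + 1 ≡ x + 1 + d [ZMOD n]
    · have hd2 : 2 ≤ d := by
        by_contra hc
        obtain rfl : d = 1 := by omega
        exact not_modEq_succ hn (x + 1) (by exact_mod_cast h)
      obtain ⟨k, hk⟩ := modEq_iff_exists_add.1 h.symm
      have hk' : x + d = x + k * n := by linarith
      have e : x + 1 + 1 + ((d - 2 : ℕ) : ℤ) = x + k * n := by
        rw [← hk']; push_cast [hd2]; ring
      have hne' : ¬ x + 1 ≡ x + k * n [ZMOD n] := fun hc =>
        not_modEq_succ hn x (hc.trans (add_mul_modEq x k)).symm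
      obtain ⟨r, hr, hr'⟩ := ih (d - 2) (by omega) (x + 1) (by rw [e]; exact hne')
      rw [e] at hr'
      obtain ⟨t, ht, ht'⟩ := hconj hr hne' hr'
      refine ⟨t, ht, fun z => ?_⟩
      rw [ht', adjacentSwap_succ, map_add_mul_of_map_add (adjacentSwap_add hn x),
        adjacentSwap_self, hk]
    · have e : x + 1 + 1 + ((d - 1 : ℕ) : ℤ) = x + 1 + d := by
        push_cast [hd]; ring
      obtain ⟨r, hr, hr'⟩ := ih (d - 1) (by omega) (x + 1) (by rw [e]; exact h)
      rw [e] at hr'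
      obtain ⟨t, ht, ht'⟩ := hconj hr h hr'
      refine ⟨t, ht, fun z => ?_⟩
      rw [ht', adjacentSwap_succ, adjacentSwap_of_ne hn (not_modEq_symm hne) (not_modEq_symm h)]

/-- The affine Coxeter group of type `Ã` acts on the integers by affine permutations. -/
def affineModel (hn : 2 ≤ n) : PeriodicModel cs n where
  toHom := affineHom cs hn
  pos := by omega
  injective := affineHom_injective cs hn
  map_add := affineHom_add cs hn
  exists_swap := by
    rintro _ ⟨w, i, rfl⟩
    refine ⟨affineHom cs hn w i, affineHom cs hn w (i + 1),
      fun h => not_modEq_succ hn i (modEq_of_map_modEq (affineHom_add cs hn w) h), fun z => ?_⟩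
    rw [map_mul, map_mul, Equiv.Perm.mul_apply, Equiv.Perm.mul_apply, affineHom_simple,
      adjacentSwap_apply, map_periodicSwap (affineHom_add cs hn w) (not_modEq_succ hn i),
      ← Equiv.Perm.mul_apply, ← map_mul, mul_inv_cancel, map_one, Equiv.Perm.one_apply]
  exists_reflection := by
    intro x y hne
    have hxy : x ≠ y := fun h => hne (h ▸ Int.ModEq.refl _)
    rcases lt_or_gt_of_ne hxy with h | h
    · have e : x + 1 + ((y - x - 1).toNat : ℤ) = y := by omega
      have := exists_reflection_of_lt cs hn (y - x - 1).toNat x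
      rw [e] at this
      exact this hne
    · have e : y + 1 + ((x - y - 1).toNat : ℤ) = x := by omega
      have := exists_reflection_of_lt cs hn (x - y - 1).toNat y
      rw [e] at this
      obtain ⟨r, hr, hr'⟩ := this (not_modEq_symm hne)
      exact ⟨r, hr, fun z => by rw [hr', periodicSwap_comm (not_modEq_symm hne)]⟩

end AffineSymmetric

/-! ### Coxeter elements are annular -/

section CoxeterElement

variable {n : ℕ} {W : Type*} [Group W] (cs : CoxeterSystem (affineA n) W)

/-- The position in a word of the simple reflection exchanging `x` and `x + 1`. -/
def position (hn : 2 ≤ n) (l : List (Fin n)) (x : ℤ) : ℕ := l.idxOf (residue hn x)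

variable {hn : 2 ≤ n} {l : List (Fin n)}

theorem position_congr {x y : ℤ} (h : x ≡ y [ZMOD n]) :
    position hn l x = position hn l y := by
  rw [position, position, (residue_eq_iff hn).2 h]

theorem position_ne_sub_one (hl : ∀ i, i ∈ l) (x : ℤ) :
    position hn l (x - 1) ≠ position hn l x := by
  intro h
  have h1 := (residue_eq_iff hn).1 ((List.idxOf_inj (hl _)).1 h)
  have h2 := not_modEq_succ hn (x - 1)
  rw [sub_add_cancel] at h2
  exact h2 h1

theorem position_lt (hl : ∀ i, i ∈ l) (x : ℤ) : position hn l x < l.length :=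
  List.idxOf_lt_length_of_mem (hl _)

theorem position_eq_iff (hnd : l.Nodup) {p : ℕ} (hp : p < l.length) (x : ℤ) :
    position hn l x = p ↔ x ≡ (l[p] : ℕ) [ZMOD n] := by
  constructor
  · rintro rfl
    have : l[position hn l x] = residue hn x := List.getElem_idxOf hp
    rw [this]
    exact (residue_modEq hn x).symm
  · intro h
    rw [position_congr h, position, residue_natCast, hnd.idxOf_getElem]

/-- The effect of one letter of the word. -/
theorem adjacentSwap_getElem (hnd : l.Nodup) {p : ℕ} (hp : p < l.length) (y : ℤ) :
    adjacentSwap n hn ((l[p] : ℕ) : ℤ) y =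
      if position hn l y = p then y + 1 else if position hn l (y - 1) = p then y - 1 else y := by
  split_ifs with h1 h2
  · rw [position_eq_iff hnd hp] at h1
    rw [← adjacentSwap_eq_of_modEq hn h1, adjacentSwap_self]
  · rw [position_eq_iff hnd hp] at h2
    have := adjacentSwap_succ hn (y - 1)
    rwa [sub_add_cancel, adjacentSwap_eq_of_modEq hn h2] at this
  · rw [position_eq_iff hnd hp] at h1 h2
    refine adjacentSwap_of_ne hn h1 fun h => h2 ?_
    simpa using h.sub_right 1

theorem affineHom_wordProd_drop (hnd : l.Nodup) {p : ℕ} (hp : p < l.length) (z : ℤ) :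
    affineHom cs hn (cs.wordProd (l.drop p)) z =
      let y := affineHom cs hn (cs.wordProd (l.drop (p + 1))) z
      if position hn l y = p then y + 1 else if position hn l (y - 1) = p then y - 1 else y := by
  rw [List.drop_eq_getElem_cons hp, CoxeterSystem.wordProd_cons, map_mul, Equiv.Perm.mul_apply,
    affineHom_simple, adjacentSwap_getElem hnd hp]

/-- Letters act from the right end of the word, so those of index at least p have acted. As s_z acts
before s_(z-1), z is first pushed up, and it continues upwards as long as the next simple reflection
is still to come. The clauses record which letters near y are used and which are pending. -/
theorem wordProd_drop_ascending (hnd : l.Nodup) (hl : ∀ i, i ∈ l) {z : ℤ}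
    (hz : position hn l (z - 1) < position hn l z) {p : ℕ} (hp : p ≤ l.length) {y : ℤ}
    (hy : affineHom cs hn (cs.wordProd (l.drop p)) z = y) :
    z ≤ y ∧ (∀ t, z < t → t < y → position hn l t < position hn l (t - 1)) ∧
      (y = z → position hn l z < p) ∧
      (z < y → p ≤ position hn l (y - 1) ∧
        (position hn l y < position hn l (y - 1) → position hn l y < p)) := by
  induction hp using Nat.decreasingInduction generalizing y with
  | self =>
    obtain rfl : z = y := by simpa using hy
    exact ⟨le_rfl, fun t h1 h2 => absurd h1 (by omega), fun _ => position_lt hl z,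
      fun h => absurd h (lt_irrefl _)⟩
  | of_succ p hp ih =>
    rw [affineHom_wordProd_drop cs hnd hp] at hy
    obtain ⟨h1, h2, h3, h4⟩ := ih rfl
    generalize affineHom cs hn (cs.wordProd (l.drop (p + 1))) z = x at hy h1 h2 h3 h4
    simp only at hy
    split_ifs at hy with hx hx'
    · subst hy
      have hxz : x = z ∨ z < x := by omega
      refine ⟨by omega, fun t ht ht' => ?_, fun h => by omega, fun _ => ?_⟩
      · rcases (show t < x ∨ t = x by omega) with h | rfl
        · exact h2 t ht h
        · have := (h4 ht).1
          omega
      · rw [add_sub_cancel_right]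
        exact ⟨hx.ge, fun h => by omega⟩
    · exfalso
      rcases h1.lt_or_eq with h | rfl
      · have := (h4 h).1
        omega
      · have := h3 rfl
        omega
    · subst hy
      refine ⟨h1, h2, fun h => ?_, fun h => ?_⟩
      · have := h3 h
        rw [h] at hx
        omega
      · obtain ⟨h5, h6⟩ := h4 h
        exact ⟨by omega, fun h7 => by have := h6 h7; omega⟩

/-- The mirror image: s_(z-1) acts before s_z, so z travels downwards. -/
theorem wordProd_drop_descending (hnd : l.Nodup) (hl : ∀ i, i ∈ l) {z : ℤ}
    (hz : position hn l z < position hn l (z - 1)) {p : ℕ} (hp : p ≤ l.length) {y : ℤ}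
    (hy : affineHom cs hn (cs.wordProd (l.drop p)) z = y) :
    y ≤ z ∧ (∀ t, y < t → t < z → position hn l (t - 1) < position hn l t) ∧
      (y = z → position hn l (z - 1) < p) ∧
      (y < z → p ≤ position hn l y ∧
        (position hn l (y - 1) < position hn l y → position hn l (y - 1) < p)) := by
  induction hp using Nat.decreasingInduction generalizing y with
  | self =>
    obtain rfl : z = y := by simpa using hy
    exact ⟨le_rfl, fun t h1 h2 => absurd h1 (by omega), fun _ => position_lt hl _,
      fun h => absurd h (lt_irrefl _)⟩
  | of_succ p hp ih =>
    rw [affineHom_wordProd_drop cs hnd hp] at hy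
    obtain ⟨h1, h2, h3, h4⟩ := ih rfl
    generalize affineHom cs hn (cs.wordProd (l.drop (p + 1))) z = x at hy h1 h2 h3 h4
    simp only at hy
    split_ifs at hy with hx hx'
    · exfalso
      rcases h1.lt_or_eq with h | rfl
      · have := (h4 h).1
        omega
      · have := h3 rfl
        omega
    · subst hy
      refine ⟨by omega, fun t ht ht' => ?_, fun h => by omega, fun _ => ⟨hx'.ge, fun h => by omega⟩⟩
      rcases (show x < t ∨ t = x by omega) with h | rfl
      · exact h2 t h ht'
      · have := (h4 ht').1
        omega
    · subst hy
      refine ⟨h1, h2, fun h => ?_, fun h => ?_⟩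
      · have := h3 h
        rw [h] at hx'
        omega
      · obtain ⟨h5, h6⟩ := h4 h
        exact ⟨by omega, fun h7 => by have := h6 h7; omega⟩

theorem wordProd_ascending (hnd : l.Nodup) (hl : ∀ i, i ∈ l) {z : ℤ}
    (hz : position hn l (z - 1) < position hn l z) :
    z < affineHom cs hn (cs.wordProd l) z ∧
      (∀ t, z < t → t < affineHom cs hn (cs.wordProd l) z →
        position hn l t < position hn l (t - 1)) ∧
      position hn l (affineHom cs hn (cs.wordProd l) z - 1) <
        position hn l (affineHom cs hn (cs.wordProd l) z) := by
  obtain ⟨h1, h2, h3, h4⟩ := wordProd_drop_ascending cs hnd hl hz (Nat.zero_le _) rfl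
  rw [List.drop_zero] at h1 h2 h3 h4
  generalize affineHom cs hn (cs.wordProd l) z = y at h1 h2 h3 h4 ⊢
  have hlt : z < y := lt_of_le_of_ne h1 fun h => absurd (h3 h.symm) (Nat.not_lt_zero _)
  have := position_ne_sub_one (hn := hn) hl y
  have h5 := (h4 hlt).2
  exact ⟨hlt, h2, by omega⟩

theorem wordProd_descending (hnd : l.Nodup) (hl : ∀ i, i ∈ l) {z : ℤ}
    (hz : position hn l z < position hn l (z - 1)) :
    affineHom cs hn (cs.wordProd l) z < z ∧
      (∀ t, affineHom cs hn (cs.wordProd l) z < t → t < z →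
        position hn l (t - 1) < position hn l t) ∧
      position hn l (affineHom cs hn (cs.wordProd l) z) <
        position hn l (affineHom cs hn (cs.wordProd l) z - 1) := by
  obtain ⟨h1, h2, h3, h4⟩ := wordProd_drop_descending cs hnd hl hz (Nat.zero_le _) rfl
  rw [List.drop_zero] at h1 h2 h3 h4
  generalize affineHom cs hn (cs.wordProd l) z = y at h1 h2 h3 h4 ⊢
  have hlt : y < z := lt_of_le_of_ne h1 fun h => absurd (h3 h) (Nat.not_lt_zero _)
  have := position_ne_sub_one (hn := hn) hl y
  have h5 := (h4 hlt).2
  exact ⟨hlt, h2, by omega⟩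

theorem ediv_eq_of_bounds {N m k : ℤ} (hN : 0 < N) (h1 : k * N ≤ m) (h2 : m < (k + 1) * N) :
    m / N = k := by
  have h3 := (Int.le_ediv_iff_mul_le hN).2 h1
  have h4 := (Int.ediv_lt_iff_lt_mul hN).2 h2
  omega

/-- If `u` moves the points of `U` to the next point of `U`, and the other points to the previous
point of the complement of `U`, then for `a ∈ U` and `b ∉ U` the permutation `(a b) u` preserves a
height function. -/
theorem exists_height_of_shift (hn : 0 < n) {u : ℤ → ℤ} {U : Set ℤ}
    (hU : ∀ y z : ℤ, y ≡ z [ZMOD n] → y ∈ U → z ∈ U)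
    (hup : ∀ z ∈ U, z < u z ∧ u z ∈ U ∧ ∀ t, z < t → t < u z → t ∉ U)
    (hdown : ∀ z ∉ U, u z < z ∧ u z ∉ U ∧ ∀ t, u z < t → t < z → t ∈ U)
    {a b : ℤ} (ha : a ∈ U) (hb : b ∉ U) :
    ∃ h : ℤ → ℤ, (∀ z, h (z + n) = h z + 1) ∧ h a = h b + 1 ∧
      ∀ z, h (periodicSwap n a b (u z)) = h z := by
  classical
  have hN : (0 : ℤ) < n := by exact_mod_cast hn
  have hmem {y z : ℤ} (h : y ≡ z [ZMOD n]) : y ∈ U ↔ z ∈ U := ⟨hU _ _ h, hU _ _ h.symm⟩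
  have hab : ¬ a ≡ b [ZMOD n] := fun h => hb ((hmem h).1 ha)
  have haU (k : ℤ) : a + k * n ∈ U := (hmem (add_mul_modEq a k)).2 ha
  have hbU (k : ℤ) : b + k * n ∉ U := fun h => hb ((hmem (add_mul_modEq b k)).1 h)
  -- On U this is the floor of (z - a) / n, which moving upwards changes only on landing in the
  -- class of a. Off U it is the ceiling of (z - b) / n minus 1, which moving downwards changes only
  -- on landing in the class of b. The swap of a and b compensates exactly for these jumps.
  let h : ℤ → ℤ := fun z => if z ∈ U then (z - a) / n else -((b - z) / n) - 1
  have hh (z : ℤ) : h (z + n) = h z + 1 := by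
    have e : z + n ∈ U ↔ z ∈ U := hmem (by simp [Int.ModEq])
    simp only [h, e]
    split_ifs
    · rw [show z + n - a = z - a + n by ring, Int.add_ediv_of_dvd_right dvd_rfl,
        Int.ediv_self hN.ne']
    · rw [show b - (z + n) = b - z + n * (-1) by ring, Int.add_mul_ediv_left _ _ hN.ne']
      ring
  have h0 : h a = 0 := by simp [h, ha]
  have h1 : h b = -1 := by simp [h, hb]
  refine ⟨h, hh, by rw [h0, h1]; rfl, fun z => ?_⟩
  by_cases hz : z ∈ U
  · obtain ⟨hlt, huU, hbet⟩ := hup z hz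
    have hzv : h z = (z - a) / n := if_pos hz
    by_cases hua : u z ≡ a [ZMOD n]
    · obtain ⟨k, hk⟩ := modEq_iff_exists_add.1 hua
      rw [hk, periodicSwap_left, height_add_mul hh, h1, hzv]
      have hle : a + (k - 1) * n ≤ z := by
        by_contra! hc
        exact hbet _ hc (by rw [hk]; linarith) (haU _)
      rw [ediv_eq_of_bounds hN (k := k - 1) (by linarith) (by linarith)]
      ring
    · rw [periodicSwap_of_ne hua fun hc => hb ((hmem hc).1 huU), hzv,
        show h (u z) = (u z - a) / n from if_pos huU]
      refine (ediv_eq_of_bounds hN ?_ ?_).symm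
      · have h2 := Int.ediv_mul_le (u z - a) hN.ne'
        by_contra! hc
        refine hbet (a + (u z - a) / n * n) (by linarith)
          (lt_of_le_of_ne (by linarith) fun he => ?_) (haU _)
        exact hua (modEq_iff_exists_add.2 ⟨_, he.symm⟩)
      · have h2 := Int.lt_ediv_add_one_mul_self (u z - a) hN
        linarith
  · obtain ⟨hlt, huU, hbet⟩ := hdown z hz
    have hzv : h z = -((b - z) / n) - 1 := if_neg hz
    by_cases hub : u z ≡ b [ZMOD n]
    · obtain ⟨k, hk⟩ := modEq_iff_exists_add.1 hub
      rw [hk, periodicSwap_right hab, height_add_mul hh, h0, hzv]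
      have hle : z ≤ b + (k + 1) * n := by
        by_contra! hc
        exact hbU (k + 1) (hbet _ (by rw [hk]; linarith) hc)
      rw [ediv_eq_of_bounds hN (k := -k - 1) (by linarith) (by linarith)]
      ring
    · rw [periodicSwap_of_ne (fun hc => huU ((hmem hc).2 ha)) hub, hzv,
        show h (u z) = -((b - u z) / n) - 1 from if_neg huU]
      congr 2
      refine (ediv_eq_of_bounds hN ?_ ?_).symm
      · have h2 := Int.ediv_mul_le (b - u z) hN.ne'
        by_contra! hc
        refine hbU (-((b - u z) / n)) (hbet _ (lt_of_le_of_ne (by linarith) fun he => ?_)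
          (by linarith))
        exact hub (modEq_iff_exists_add.2 ⟨_, he⟩)
      · have h2 := Int.lt_ediv_add_one_mul_self (b - u z) hN
        linarith

/-- The Coxeter element moves each point of U up to the next point of U and each point of V down to
the previous point of V; U and V partition ℤ. -/
theorem isAnnular_wordProd (hnd : l.Nodup) (hl : ∀ i, i ∈ l) :
    (affineModel cs hn).IsAnnular (cs.wordProd l)
      {z | position hn l (z - 1) < position hn l z}
      {z | position hn l z < position hn l (z - 1)} := by
  have hup {z : ℤ} := wordProd_ascending cs (z := z) (hn := hn) hnd hl
  have hdown {z : ℤ} := wordProd_descending cs (z := z) (hn := hn) hnd hl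
  have hne (z : ℤ) := position_ne_sub_one (hn := hn) hl z
  have hdich (z : ℤ) : ¬ position hn l (z - 1) < position hn l z →
      position hn l z < position hn l (z - 1) := fun h => by have := hne z; omega
  have hper {y z : ℤ} (h : y ≡ z [ZMOD n]) :
      position hn l y = position hn l z ∧ position hn l (y - 1) = position hn l (z - 1) :=
    ⟨position_congr h, position_congr (h.sub_right 1)⟩
  have hpos : 0 < l.length := List.length_pos_of_mem (hl (residue hn 0))
  have hx0 : position hn l ((l[0] : ℕ) : ℤ) = 0 :=
    (position_eq_iff hnd hpos _).2 (Int.ModEq.refl _)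
  refine ⟨⟨((l[0] : ℕ) : ℤ) + 1, ?_⟩, ⟨((l[0] : ℕ) : ℤ), ?_⟩, fun z => ?_, fun y z h => ?_,
    fun y z h => ?_, fun z => ?_, fun z => ?_, fun a ha b hb => ?_⟩ <;>
    simp only [Set.mem_ofPred_eq] at *
  -- The first letter has the minimal position 0, so its index lies in V and the successor of that
  -- index in U.
  · have := hne (((l[0] : ℕ) : ℤ) + 1)
    rw [add_sub_cancel_right, hx0] at this ⊢
    omega
  · have := hne ((l[0] : ℕ) : ℤ)
    rw [hx0] at this ⊢
    omega
  · exact fun h => lt_asymm h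
  · rw [(hper h).1, (hper h).2]
    exact id
  · rw [(hper h).1, (hper h).2]
    exact id
  · refine ⟨fun h => ?_, fun h => (hup h).2.2⟩
    by_contra hc
    exact lt_asymm h (hdown (hdich z hc)).2.2
  · refine ⟨fun h => ?_, fun h => (hdown h).2.2⟩
    by_contra hc
    exact lt_asymm h (hup (lt_of_le_of_ne (not_lt.1 hc) (hne z))).2.2
  · refine exists_height_of_shift (affineModel cs hn).pos
      (U := {z | position hn l (z - 1) < position hn l z}) ?_ ?_ ?_ ?_ ?_ <;>
      simp only [Set.mem_ofPred_eq]
    · intro y z h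
      rw [(hper h).1, (hper h).2]
      exact id
    · exact fun z hz => ⟨(hup hz).1, (hup hz).2.2, fun t h1 h2 => lt_asymm ((hup hz).2.1 t h1 h2)⟩
    · exact fun z hz => ⟨(hdown (hdich z hz)).1, lt_asymm (hdown (hdich z hz)).2.2,
        (hdown (hdich z hz)).2.1⟩
    · exact ha
    · exact lt_asymm hb

end CoxeterElement

end DualArtin

theorem proposition3p3 (n : ℕ) (hn : 2 ≤ n) {W : Type*} [Group W]
    (cs : CoxeterSystem (DualArtin.affineA n) W) (c : W)
    (hc : DualArtin.IsCoxeterElement cs c) :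
    (∃ φ : PresentedMonoid (DualArtin.HurwitzRel cs c) ≃* DualArtin.DualMonoid cs c,
      ∀ r : DualArtin.ReflDivisor cs c,
        φ (PresentedMonoid.of (DualArtin.HurwitzRel cs c) r) =
          DualArtin.DualMonoid.under cs c r.1 r.2.2) ∧
    (∃ ψ : PresentedGroup (DualArtin.hurwitzRelators cs c) ≃*
        DualArtin.GroupOfFractions (DualArtin.DualMonoid cs c),
      ∀ r : DualArtin.ReflDivisor cs c,
        ψ (PresentedGroup.of r) =
          DualArtin.GroupOfFractions.ofMonoid (DualArtin.DualMonoid cs c)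
            (DualArtin.DualMonoid.under cs c r.1 r.2.2)) := by
  obtain ⟨l, hnd, hl, rfl⟩ := hc
  have hadm : (DualArtin.affineModel cs hn).IsAdmissible (cs.wordProd l) :=
    Or.inr ⟨_, _, DualArtin.isAnnular_wordProd cs hnd hl⟩
  obtain ⟨φ, hφ⟩ := DualArtin.exists_hurwitz_mulEquiv_dual (cs := cs) (c := cs.wordProd l)
    fun w hw r t => (hadm.of_divides hw).connected
  exact ⟨⟨φ, hφ⟩, DualArtin.exists_hurwitz_mulEquiv_fractions φ hφ⟩
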